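/- Let $g\ge 2$ and let $f\in\mathbb{C}[x]$ be a polynomial of degree $2g+1$ or $2g+2$ with pairwise distinct roots. Put $h(z)=z^{2g+2}f(1/z)$, and let $X$ be the complex hyperelliptic curve of genus $g$ defined by $y^2=f(x)$: the compact Riemann surface obtained by gluing the affine curves $C_0=\{y^2=f(x)\}$ and $C_0'=\{w^2=h(z)\}$ along $(x,y)\mapsto(z,w)=(1/x,\,y/x^{g+1})$ (for $x\neq0$). Let $\iota$ be the hyperelliptic involution, $(x,y)\mapsto(x,-y)$ on $C_0$ and $(z,w)\mapsto(z,-w)$ on $C_0'$, extended to $\operatorname{Div}(X)$ by linearity. Equip $X$ with the canonical metric $ds^2=\sum_{i=1}^{g}\omega_i\otimes\overline{\omega_i}$, where $\omega_i=x^{i-1}\,dx/y$; if $ds^2=\rho\,d\zeta\otimes d\bar\zeta$ in a holomorphic coordinate $\zeta=s+\mathrm{i}t$, its volume form is $d\nu=\rho\,ds\,dt$ and its Laplacian is $\Delta=\frac1\rho\left(\partial_s^2+\partial_t^2\right)$. Let $\sigma_g(t)=1+t+\cdots+t^{g-1}$ and $N(t)=\left(\sigma_g(t)(1+t)^2\right)^{1/(2g+2)}$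 for $t\ge 0$. For $P\in C_0$ let $$F_P(Q)=\frac{|x(Q)-x(P)|}{N(|x(Q)|^2)}\ \text{ if } Q\in C_0,\qquad F_P(Q)=\frac{|1-z(Q)x(P)|}{N(|z(Q)|^2)}\ \text{ if } Q\in C_0',$$ and for a point $P$ at infinity (a point of $C_0'$ with $z(P)=0$) let $$F_P(Q)=\frac{1}{N(|x(Q)|^2)}\ \text{ if } Q\in C_0,\qquad F_P(Q)=\frac{|z(Q)|}{N(|z(Q)|^2)}\ \text{ if } Q\in C_0'.$$ For a divisor $D=\sum_P n_P P$ on $X$ let $F_D=\prod_P F_P^{n_P}$, $u_D=\log F_D$ (outside a finite set) and $\delta_D(\varphi)=\sum_P n_P\varphi(P)$ for $\varphi\in C^\infty(X,\mathbb{C})$. If $D$ is a divisor of degree $0$ on $X$, then $$\Delta u_D=2\pi\,\delta_{D+\iota(D)}$$ as distributions, i.e. as continuous linear functionals on $C^\infty(X,\mathbb{C})$ with its Fréchet topology. Explicitly: for every $\varphi\in C^\infty(X,\mathbb{C})$ the function $u_D\,\Delta\varphi$ is integrable on $X$ with respect to $d\nu$, and for every choice of holomorphic coordinates $\zeta_Q$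 centred at the points $Q$ of $S=\operatorname{supp}(D+\iota(D))$, with $D_\varepsilon(Q)=\{|\zeta_Q|\le\varepsilon\}$, $$\lim_{\varepsilon\to0+}\int_{X\setminus\bigcup_{Q\in S}D_\varepsilon(Q)}u_D\,\Delta\varphi\;d\nu=2\pi\,\delta_{D+\iota(D)}(\varphi).$$ -/

import Mathlib

open Set Filter Topology MeasureTheory
open scoped Manifold ContDiff

/-- The affine plane curve `y ^ 2 = p x`, with the subspace topology of `ℂ × ℂ`. -/
abbrev AffineCurve (p : Polynomial ℂ) : Type := {q : ℂ × ℂ // q.2 ^ 2 = p.eval q.1}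

namespace AffineCurve

variable (p : Polynomial ℂ)

theorem sqrt_re_pos {u : ℂ} (hu : u ∈ Complex.slitPlane) : 0 < (u ^ (2⁻¹ : ℂ)).re := by
  rw [Complex.cpow_inv_two_re]
  apply Real.sqrt_pos.2
  rcases Complex.mem_slitPlane_iff.1 hu with h | h
  · have := norm_nonneg u
    linarith
  · have : |u.re| < ‖u‖ := Complex.abs_re_lt_norm.2 h
    have := neg_abs_le u.re
    linarith

theorem sq_mem_slitPlane {v : ℂ} (hv : 0 < v.re) : v ^ 2 ∈ Complex.slitPlane := by
  rw [Complex.mem_slitPlane_iff]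
  by_cases h : v.im = 0
  · left
    simp [pow_two, h, hv]
  · right
    have h2 : (v ^ 2).im = 2 * (v.re * v.im) := by
      rw [pow_two, Complex.mul_im]
      ring
    rw [h2]
    exact mul_ne_zero two_ne_zero (mul_ne_zero hv.ne' h)

/-- The chart `(x, y) ↦ x` near a point with `y = b ≠ 0`; its inverse is
`x ↦ (x, b * √(p x / b ^ 2))`. -/
noncomputable def xChart (b : ℂ) (hb : b ≠ 0) : OpenPartialHomeomorph (AffineCurve p) ℂ where
  toFun q := q.1.1
  invFun x := ⟨(x, b * (p.eval x / b ^ 2) ^ (2⁻¹ : ℂ)), by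
    rw [mul_pow, Complex.cpow_ofNat_inv_pow]
    field_simp⟩
  source := {q | 0 < (q.1.2 / b).re}
  target := {x | p.eval x / b ^ 2 ∈ Complex.slitPlane}
  map_source' q hq := by
    have := sq_mem_slitPlane hq
    rwa [div_pow, q.2] at this
  map_target' x hx := by
    have := sqrt_re_pos hx
    simpa [hb] using this
  left_inv' q hq := by
    apply Subtype.ext
    refine Prod.ext rfl ?_
    change b * (p.eval q.1.1 / b ^ 2) ^ (2⁻¹ : ℂ) = q.1.2
    rw [← q.2, ← div_pow, Complex.sq_cpow_two_inv hq]
    field_simp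
  right_inv' x _ := rfl
  open_source := isOpen_lt continuous_const (by fun_prop)
  open_target := Complex.isOpen_slitPlane.preimage (by fun_prop)
  continuousOn_toFun := by fun_prop
  continuousOn_invFun := by
    apply Topology.IsInducing.subtypeVal.continuousOn_iff.2
    refine continuousOn_id.prodMk (continuousOn_const.mul ?_)
    exact ContinuousOn.cpow_const (by fun_prop) fun x hx => hx

/-- A local inverse of `p` near a point with `p' a ≠ 0`, on a domain where `p' ≠ 0`. -/
noncomputable def localHomeo (a : ℂ) (ha : p.derivative.eval a ≠ 0) :
    OpenPartialHomeomorph ℂ ℂ :=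
  (((p.hasStrictDerivAt a).hasStrictFDerivAt_equiv ha).toOpenPartialHomeomorph _).restrOpen
    {x | p.derivative.eval x ≠ 0} (isOpen_ne_fun (by fun_prop) (by fun_prop))

theorem localHomeo_apply (a : ℂ) (ha : p.derivative.eval a ≠ 0) (x : ℂ) :
    localHomeo p a ha x = p.eval x := rfl

theorem mem_localHomeo_source (a : ℂ) (ha : p.derivative.eval a ≠ 0) :
    a ∈ (localHomeo p a ha).source :=
  ⟨((p.hasStrictDerivAt a).hasStrictFDerivAt_equiv ha).mem_toOpenPartialHomeomorph_source, ha⟩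

/-- The chart `(x, y) ↦ y` near a point with `x = a`, `p' a ≠ 0`. -/
noncomputable def yChart (a : ℂ) (ha : p.derivative.eval a ≠ 0) :
    OpenPartialHomeomorph (AffineCurve p) ℂ where
  toFun q := q.1.2
  invFun y := open scoped Classical in
    if hy : y ^ 2 ∈ (localHomeo p a ha).target then
      ⟨((localHomeo p a ha).symm (y ^ 2), y), by
        change y ^ 2 = _
        rw [← localHomeo_apply p a ha, (localHomeo p a ha).right_inv hy]⟩
    else ⟨(a, (p.eval a) ^ (2⁻¹ : ℂ)), by
      rw [Complex.cpow_ofNat_inv_pow]⟩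
  source := {q | q.1.1 ∈ (localHomeo p a ha).source}
  target := {y | y ^ 2 ∈ (localHomeo p a ha).target}
  map_source' q hq := by
    have := (localHomeo p a ha).map_source hq
    rwa [localHomeo_apply, ← q.2] at this
  map_target' y hy := by
    have hy' : y ^ 2 ∈ (localHomeo p a ha).target := hy
    simp only [mem_ofPred_eq, hy', dif_pos]
    exact (localHomeo p a ha).map_target hy'
  left_inv' q hq := by
    have hy : q.1.2 ^ 2 ∈ (localHomeo p a ha).target := by
      have := (localHomeo p a ha).map_source hq
      rwa [localHomeo_apply, ← q.2] at this
    apply Subtype.ext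
    simp only [hy, dif_pos]
    refine Prod.ext ?_ rfl
    change (localHomeo p a ha).symm (q.1.2 ^ 2) = q.1.1
    rw [q.2, ← localHomeo_apply p a ha, (localHomeo p a ha).left_inv hq]
  right_inv' y hy := by
    have hy' : y ^ 2 ∈ (localHomeo p a ha).target := hy
    simp [hy']
  open_source := (localHomeo p a ha).open_source.preimage (by fun_prop)
  open_target := (localHomeo p a ha).open_target.preimage (by fun_prop)
  continuousOn_toFun := by fun_prop
  continuousOn_invFun := by
    apply Topology.IsInducing.subtypeVal.continuousOn_iff.2
    have : ContinuousOn (fun y : ℂ => ((localHomeo p a ha).symm (y ^ 2), y))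
        {y | y ^ 2 ∈ (localHomeo p a ha).target} :=
      ((localHomeo p a ha).continuousOn_symm.comp (f := fun y : ℂ => y ^ 2)
        (by fun_prop) fun y hy => hy).prodMk continuousOn_id
    refine this.congr fun y hy => ?_
    have hy' : y ^ 2 ∈ (localHomeo p a ha).target := hy
    simp [hy']

/-- The chart at a nonsingular point: `x` where `y ≠ 0` and `y` where `y = 0`. -/
noncomputable def chart (q : AffineCurve p) (hq : q.1.2 ≠ 0 ∨ p.derivative.eval q.1.1 ≠ 0) :
    OpenPartialHomeomorph (AffineCurve p) ℂ := open scoped Classical in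
  if h : q.1.2 = 0 then yChart p q.1.1 (hq.resolve_left (not_not.2 h)) else xChart p q.1.2 h

theorem mem_chart_source (q : AffineCurve p)
    (hq : q.1.2 ≠ 0 ∨ p.derivative.eval q.1.1 ≠ 0) : q ∈ (chart p q hq).source := by
  unfold chart
  split_ifs with h
  · exact mem_localHomeo_source p _ _
  · change 0 < (q.1.2 / q.1.2).re
    simp [h]

theorem chart_apply (q : AffineCurve p) (hq : q.1.2 ≠ 0 ∨ p.derivative.eval q.1.1 ≠ 0) :
    (∀ r, chart p q hq r = r.1.1) ∨ (∀ r, chart p q hq r = r.1.2) := by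
  unfold chart
  split_ifs with h
  · exact Or.inr fun r => rfl
  · exact Or.inl fun r => rfl

theorem chart_symm_differentiableOn (q : AffineCurve p)
    (hq : q.1.2 ≠ 0 ∨ p.derivative.eval q.1.1 ≠ 0) :
    DifferentiableOn ℂ (fun z => ((chart p q hq).symm z).1.1) (chart p q hq).target ∧
    DifferentiableOn ℂ (fun z => ((chart p q hq).symm z).1.2) (chart p q hq).target := by
  unfold chart
  split_ifs with h
  · have ha := hq.resolve_left (not_not.2 h)
    constructor
    · have key : DifferentiableOn ℂ (localHomeo p q.1.1 ha).symm (localHomeo p q.1.1 ha).target := by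
        intro w hw
        have hs := (localHomeo p q.1.1 ha).map_target hw
        have hd : p.derivative.eval ((localHomeo p q.1.1 ha).symm w) ≠ 0 := hs.2
        exact ((localHomeo p q.1.1 ha).hasDerivAt_symm hw hd
          (p.hasDerivAt _)).differentiableAt.differentiableWithinAt
      have key2 := key.comp (f := fun y : ℂ => y ^ 2)
        (s := {y | y ^ 2 ∈ (localHomeo p q.1.1 ha).target}) (by fun_prop) fun y hy => hy
      refine key2.congr fun y hy => ?_
      have hy' : y ^ 2 ∈ (localHomeo p q.1.1 ha).target := hy
      simp [yChart, hy']
    · refine differentiableOn_id.congr fun y hy => ?_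
      exact (yChart p q.1.1 ha).right_inv hy
  · constructor
    · exact differentiableOn_id
    · change DifferentiableOn ℂ (fun x => q.1.2 * (p.eval x / q.1.2 ^ 2) ^ (2⁻¹ : ℂ)) _
      refine DifferentiableOn.const_mul (fun x hx => ?_) _
      exact DifferentiableWithinAt.cpow_const
        (p.differentiable.differentiableAt.differentiableWithinAt.div_const _) hx

end AffineCurve

/-- The data of an equation `y ^ 2 = f x`, where `f` has degree `2 * g + 1` or `2 * g + 2` and
pairwise distinct roots. -/
structure HyperellipticEquation (g : ℕ) where
  f : Polynomial ℂ
  natDegree_eq : f.natDegree = 2 * g + 1 ∨ f.natDegree = 2 * g + 2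
  separable : f.Separable

namespace HyperellipticEquation

variable {g : ℕ} (E : HyperellipticEquation g)

/-- The polynomial `z ^ (2 * g + 2) * f (1 / z)`. -/
noncomputable def h : Polynomial ℂ := E.f.reflect (2 * g + 2)

theorem eval_h {z : ℂ} (hz : z ≠ 0) : E.h.eval z = z ^ (2 * g + 2) * E.f.eval z⁻¹ := by
  have hd : E.f.natDegree ≤ 2 * g + 2 := by
    rcases E.natDegree_eq with h | h <;> omega
  let _ : Invertible z⁻¹ := invertibleOfNonzero (inv_ne_zero hz)
  have := Polynomial.eval₂_reflect_mul_pow (RingHom.id ℂ) z⁻¹ (2 * g + 2) E.f hd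
  simp only [invOf_eq_inv, inv_inv] at this
  change Polynomial.eval₂ _ _ E.h * _ = _ at this
  simp only [Polynomial.eval₂_id] at this
  rw [← this, inv_pow]
  field_simp

theorem h_nonsingular (w : ℂ) (hw : w ^ 2 = E.h.eval 0) :
    w ≠ 0 ∨ E.h.derivative.eval 0 ≠ 0 := by
  by_contra! hcon
  obtain ⟨h0, h1⟩ := hcon
  rw [h0, h, ← Polynomial.coeff_zero_eq_eval_zero, Polynomial.coeff_reflect] at hw
  rw [← Polynomial.coeff_zero_eq_eval_zero, Polynomial.coeff_derivative, h,
    Polynomial.coeff_reflect] at h1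
  have e0 : Polynomial.revAt (2 * g + 2) 0 = 2 * g + 2 := by
    rw [Polynomial.revAt_le (by omega)]; omega
  have e1 : Polynomial.revAt (2 * g + 2) (0 + 1) = 2 * g + 1 := by
    rw [Polynomial.revAt_le (by omega)]; omega
  rw [e0] at hw
  rw [e1] at h1
  have hne : E.f ≠ 0 := E.separable.ne_zero
  have hl : E.f.coeff E.f.natDegree ≠ 0 := by simpa using hne
  rcases E.natDegree_eq with hd | hd <;> rw [hd] at hl
  · simp at h1
    exact hl h1
  · simp at hw
    exact hl hw.symm

theorem f_nonsingular (x y : ℂ) (hy : y ^ 2 = E.f.eval x) :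
    y ≠ 0 ∨ E.f.derivative.eval x ≠ 0 := by
  by_contra! hcon
  obtain ⟨h0, h1⟩ := hcon
  rw [h0] at hy
  obtain ⟨a, b, hab⟩ := E.separable
  have := congrArg (Polynomial.eval x) hab
  simp [← hy, h1] at this

end HyperellipticEquation

/-- The points of the complex hyperelliptic curve `X` of `y ^ 2 = f x`: those of the affine curve
`C₀ : y ^ 2 = f x`, and those with `z = 0` of the affine curve `C₀' : w ^ 2 = h z`, where
`h z = z ^ (2 * g + 2) * f (1 / z)`. -/
inductive HyperellipticCurve {g : ℕ} (E : HyperellipticEquation g) : Type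
  | affine (x y : ℂ) (hy : y ^ 2 = E.f.eval x) : HyperellipticCurve E
  | infinity (w : ℂ) (hw : w ^ 2 = E.h.eval 0) : HyperellipticCurve E

namespace HyperellipticCurve

variable {g : ℕ} {E : HyperellipticEquation g}

/-- The inclusion of `C₀` in `X`. -/
def ofAffine (q : AffineCurve E.f) : HyperellipticCurve E := affine q.1.1 q.1.2 q.2

/-- The inclusion of `C₀'` in `X`; the point `(z, w)` with `z ≠ 0` is glued to the point
`(1 / z, w / z ^ (g + 1))` of `C₀`. -/
noncomputable def ofInfinity (q : AffineCurve E.h) : HyperellipticCurve E :=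
  open scoped Classical in
  if hz : q.1.1 = 0 then infinity q.1.2 (by rw [q.2, hz])
  else affine q.1.1⁻¹ (q.1.2 / q.1.1 ^ (g + 1)) (by
    rw [div_pow, q.2, E.eval_h hz]
    field_simp
    ring)

/-- `X` carries the quotient topology of the gluing of `C₀` and `C₀'`. -/
noncomputable instance : TopologicalSpace (HyperellipticCurve E) :=
  TopologicalSpace.coinduced (Sum.elim (ofAffine (E := E)) ofInfinity) inferInstance

theorem isOpen_iff' {s : Set (HyperellipticCurve E)} :
    IsOpen s ↔ IsOpen (ofAffine (E := E) ⁻¹' s) ∧ IsOpen (ofInfinity (E := E) ⁻¹' s) := by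
  rw [isOpen_coinduced, isOpen_sum_iff]
  rfl

theorem ofAffine_eq_ofInfinity (q : AffineCurve E.f) (r : AffineCurve E.h) :
    ofAffine q = ofInfinity r ↔
      r.1.1 ≠ 0 ∧ q.1.1 = r.1.1⁻¹ ∧ q.1.2 = r.1.2 / r.1.1 ^ (g + 1) := by
  unfold ofAffine ofInfinity
  split_ifs with hz <;> simp [hz]

theorem ofAffine_eq_ofInfinity' (q : AffineCurve E.f) (r : AffineCurve E.h) :
    ofAffine q = ofInfinity r ↔
      q.1.1 ≠ 0 ∧ r.1.1 = q.1.1⁻¹ ∧ r.1.2 = q.1.2 / q.1.1 ^ (g + 1) := by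
  rw [ofAffine_eq_ofInfinity]
  constructor
  · rintro ⟨h1, h2, h3⟩
    rw [h3, h2]
    refine ⟨inv_ne_zero h1, by simp, ?_⟩
    rw [inv_pow]
    field_simp
  · rintro ⟨h1, h2, h3⟩
    rw [h3, h2]
    refine ⟨inv_ne_zero h1, by simp, ?_⟩
    rw [inv_pow]
    field_simp

theorem ofAffine_injective : Function.Injective (ofAffine (E := E)) := by
  intro q r h
  simp only [ofAffine, affine.injEq] at h
  exact Subtype.ext (Prod.ext h.1 h.2)

theorem ofInfinity_injective : Function.Injective (ofInfinity (E := E)) := by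
  intro q r h
  unfold ofInfinity at h
  split_ifs at h with h1 h2 h2
  · simp only [infinity.injEq] at h
    exact Subtype.ext (Prod.ext (h1.trans h2.symm) h)
  · simp only [affine.injEq, inv_inj] at h
    refine Subtype.ext (Prod.ext h.1 ?_)
    have h3 := h.2
    rw [h.1] at h3
    field_simp at h3
    exact h3

theorem isOpenEmbedding_ofAffine : IsOpenEmbedding (ofAffine (E := E)) := by
  have hc : Continuous (ofAffine (E := E)) :=
    continuous_def.2 fun s hs => (isOpen_iff'.1 hs).1
  refine .of_continuous_injective_isOpenMap hc ofAffine_injective fun s hs => ?_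
  rw [isOpen_iff', preimage_image_eq _ ofAffine_injective]
  refine ⟨hs, ?_⟩
  obtain ⟨t, ht, rfl⟩ := isOpen_induced_iff.1 hs
  have : ofInfinity (E := E) ⁻¹' (ofAffine '' (Subtype.val ⁻¹' t)) =
      {r | r.1.1 ≠ 0} ∩ (fun r => (r.1.1⁻¹, r.1.2 / r.1.1 ^ (g + 1))) ⁻¹' t := by
    ext r
    constructor
    · rintro ⟨q, hq, hqr⟩
      obtain ⟨h1, h2, h3⟩ := (ofAffine_eq_ofInfinity q r).1 hqr
      refine ⟨h1, ?_⟩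
      change (r.1.1⁻¹, r.1.2 / r.1.1 ^ (g + 1)) ∈ t
      rw [← h2, ← h3]
      exact hq
    · rintro ⟨h1, h2⟩
      have h1' : r.1.1 ≠ 0 := h1
      refine ⟨⟨(r.1.1⁻¹, r.1.2 / r.1.1 ^ (g + 1)), ?_⟩, h2,
        (ofAffine_eq_ofInfinity _ _).2 ⟨h1, rfl, rfl⟩⟩
      rw [div_pow, r.2, E.eval_h h1]
      field_simp
      ring
  rw [this]
  refine ContinuousOn.isOpen_inter_preimage ?_ (isOpen_ne_fun (by fun_prop) (by fun_prop)) ht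
  refine ContinuousOn.prodMk (ContinuousOn.inv₀ (by fun_prop) fun r hr => hr) ?_
  exact ContinuousOn.div (by fun_prop) (by fun_prop) fun r hr => pow_ne_zero _ hr

theorem isOpenEmbedding_ofInfinity : IsOpenEmbedding (ofInfinity (E := E)) := by
  have hc : Continuous (ofInfinity (E := E)) :=
    continuous_def.2 fun s hs => (isOpen_iff'.1 hs).2
  refine .of_continuous_injective_isOpenMap hc ofInfinity_injective fun s hs => ?_
  rw [isOpen_iff', preimage_image_eq _ ofInfinity_injective]
  refine ⟨?_, hs⟩
  obtain ⟨t, ht, rfl⟩ := isOpen_induced_iff.1 hs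
  have : ofAffine (E := E) ⁻¹' (ofInfinity '' (Subtype.val ⁻¹' t)) =
      {q | q.1.1 ≠ 0} ∩ (fun q => (q.1.1⁻¹, q.1.2 / q.1.1 ^ (g + 1))) ⁻¹' t := by
    ext q
    constructor
    · rintro ⟨r, hr, hqr⟩
      obtain ⟨h1, h2, h3⟩ := (ofAffine_eq_ofInfinity' q r).1 hqr.symm
      refine ⟨h1, ?_⟩
      change (q.1.1⁻¹, q.1.2 / q.1.1 ^ (g + 1)) ∈ t
      rw [← h2, ← h3]
      exact hr
    · rintro ⟨h1, h2⟩
      have h1' : q.1.1 ≠ 0 := h1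
      refine ⟨⟨(q.1.1⁻¹, q.1.2 / q.1.1 ^ (g + 1)), ?_⟩, h2,
        ((ofAffine_eq_ofInfinity' _ _).2 ⟨h1, rfl, rfl⟩).symm⟩
      rw [div_pow, q.2, E.eval_h (inv_ne_zero h1), inv_inv, inv_pow]
      field_simp
      ring
  rw [this]
  refine ContinuousOn.isOpen_inter_preimage ?_ (isOpen_ne_fun (by fun_prop) (by fun_prop)) ht
  refine ContinuousOn.prodMk (ContinuousOn.inv₀ (by fun_prop) fun r hr => hr) ?_
  exact ContinuousOn.div (by fun_prop) (by fun_prop) fun r hr => pow_ne_zero _ hr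

/-- The chart of `X` at a point, by one of the coordinates `x`, `y` of `C₀` or `z`, `w` of
`C₀'`. -/
noncomputable def chart : HyperellipticCurve E → OpenPartialHomeomorph (HyperellipticCurve E) ℂ
  | affine x y hy => (AffineCurve.chart E.f ⟨(x, y), hy⟩
      (E.f_nonsingular x y hy)).lift_openEmbedding isOpenEmbedding_ofAffine
  | infinity w hw => (AffineCurve.chart E.h ⟨(0, w), hw⟩
      (E.h_nonsingular w hw)).lift_openEmbedding isOpenEmbedding_ofInfinity

theorem mem_chart_source' (P : HyperellipticCurve E) : P ∈ (chart P).source := by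
  cases P with
  | affine x y hy => exact ⟨⟨(x, y), hy⟩, AffineCurve.mem_chart_source _ _ _, rfl⟩
  | infinity w hw => exact ⟨⟨(0, w), hw⟩, AffineCurve.mem_chart_source _ _ _, by simp [ofInfinity]⟩

noncomputable instance : ChartedSpace ℂ (HyperellipticCurve E) where
  atlas := Set.range chart
  chartAt := chart
  mem_chart_source := mem_chart_source'
  chart_mem_atlas := Set.mem_range_self

theorem transition_differentiableOn (P Q : HyperellipticCurve E) :
    DifferentiableOn ℂ (chart Q ∘ (chart P).symm) ((chart P).symm.trans (chart Q)).source := by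
  rintro z ⟨hz, hz'⟩
  have hop : ((chart P).symm.trans (chart Q)).source ∈ 𝓝 z :=
    ((chart P).symm.trans (chart Q)).open_source.mem_nhds ⟨hz, hz'⟩
  refine DifferentiableAt.differentiableWithinAt ?_
  cases P with
  | affine x y hy =>
    set c := AffineCurve.chart E.f ⟨(x, y), hy⟩ (E.f_nonsingular x y hy) with hc
    have ho : c.target ∈ 𝓝 z := c.open_target.mem_nhds hz
    obtain ⟨d1, d2⟩ := AffineCurve.chart_symm_differentiableOn E.f ⟨(x, y), hy⟩
        (E.f_nonsingular x y hy)
    replace d1 := d1.differentiableAt ho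
    replace d2 := d2.differentiableAt ho
    cases Q with
    | affine x' y' hy' =>
      have hcc : ∀ t, (chart (affine x' y' hy') ∘ (chart (affine x y hy)).symm) t =
          AffineCurve.chart E.f ⟨(x', y'), hy'⟩ (E.f_nonsingular x' y' hy') (c.symm t) :=
        fun t => OpenPartialHomeomorph.lift_openEmbedding_apply _ isOpenEmbedding_ofAffine
      rw [funext hcc]
      rcases AffineCurve.chart_apply E.f ⟨(x', y'), hy'⟩
        (E.f_nonsingular x' y' hy') with h | h
      · simpa only [h] using d1
      · simpa only [h] using d2
    | infinity w hw =>
      have hcc : ∀ t ∈ ((chart (affine x y hy)).symm.trans (chart (infinity w hw))).source,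
          ∃ r : AffineCurve E.h, (chart (infinity w hw) ∘ (chart (affine x y hy)).symm) t =
          AffineCurve.chart E.h ⟨(0, w), hw⟩ (E.h_nonsingular w hw) r ∧
          (c.symm t).1.1 ≠ 0 ∧ r.1.1 = (c.symm t).1.1⁻¹ ∧
          r.1.2 = (c.symm t).1.2 / (c.symm t).1.1 ^ (g + 1) := by
        rintro t ⟨ht, ⟨r, hr, hrt⟩⟩
        refine ⟨r, ?_, (ofAffine_eq_ofInfinity' _ _).1 hrt.symm⟩
        have hrt' : ofInfinity r = (chart (affine x y hy)).symm t := hrt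
        rw [Function.comp_apply, ← hrt']
        exact OpenPartialHomeomorph.lift_openEmbedding_apply _ isOpenEmbedding_ofInfinity
      have hne : (c.symm z).1.1 ≠ 0 := by
        obtain ⟨r, -, h, -⟩ := hcc z ⟨hz, hz'⟩
        exact h
      rcases AffineCurve.chart_apply E.h ⟨(0, w), hw⟩
        (E.h_nonsingular w hw) with h | h
      · refine DifferentiableAt.congr_of_eventuallyEq (d1.inv hne) ?_
        filter_upwards [hop] with t ht
        obtain ⟨r, h1, -, h2, -⟩ := hcc t ht
        rw [h1, h, h2]; rfl
      · refine DifferentiableAt.congr_of_eventuallyEq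
          (d2.div (d1.pow (g + 1)) (pow_ne_zero _ hne)) ?_
        filter_upwards [hop] with t ht
        obtain ⟨r, h1, -, -, h2⟩ := hcc t ht
        rw [h1, h, h2]; rfl
  | infinity w hw =>
    set c := AffineCurve.chart E.h ⟨(0, w), hw⟩ (E.h_nonsingular w hw) with hc
    have ho : c.target ∈ 𝓝 z := c.open_target.mem_nhds hz
    obtain ⟨d1, d2⟩ := AffineCurve.chart_symm_differentiableOn E.h ⟨(0, w), hw⟩
        (E.h_nonsingular w hw)
    replace d1 := d1.differentiableAt ho
    replace d2 := d2.differentiableAt ho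
    cases Q with
    | infinity w' hw' =>
      have hcc : ∀ t, (chart (infinity w' hw') ∘ (chart (infinity w hw)).symm) t =
          AffineCurve.chart E.h ⟨(0, w'), hw'⟩ (E.h_nonsingular w' hw') (c.symm t) :=
        fun t => OpenPartialHomeomorph.lift_openEmbedding_apply _ isOpenEmbedding_ofInfinity
      rw [funext hcc]
      rcases AffineCurve.chart_apply E.h ⟨(0, w'), hw'⟩
        (E.h_nonsingular w' hw') with h | h
      · simpa only [h] using d1
      · simpa only [h] using d2
    | affine x y hy =>
      have hcc : ∀ t ∈ ((chart (infinity w hw)).symm.trans (chart (affine x y hy))).source,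
          ∃ r : AffineCurve E.f, (chart (affine x y hy) ∘ (chart (infinity w hw)).symm) t =
          AffineCurve.chart E.f ⟨(x, y), hy⟩ (E.f_nonsingular x y hy) r ∧
          (c.symm t).1.1 ≠ 0 ∧ r.1.1 = (c.symm t).1.1⁻¹ ∧
          r.1.2 = (c.symm t).1.2 / (c.symm t).1.1 ^ (g + 1) := by
        rintro t ⟨ht, ⟨r, hr, hrt⟩⟩
        refine ⟨r, ?_, (ofAffine_eq_ofInfinity _ _).1 hrt⟩
        have hrt' : ofAffine r = (chart (infinity w hw)).symm t := hrt
        rw [Function.comp_apply, ← hrt']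
        exact OpenPartialHomeomorph.lift_openEmbedding_apply _ isOpenEmbedding_ofAffine
      have hne : (c.symm z).1.1 ≠ 0 := by
        obtain ⟨r, -, h, -⟩ := hcc z ⟨hz, hz'⟩
        exact h
      rcases AffineCurve.chart_apply E.f ⟨(x, y), hy⟩
        (E.f_nonsingular x y hy) with h | h
      · refine DifferentiableAt.congr_of_eventuallyEq (d1.inv hne) ?_
        filter_upwards [hop] with t ht
        obtain ⟨r, h1, -, h2, -⟩ := hcc t ht
        rw [h1, h, h2]; rfl
      · refine DifferentiableAt.congr_of_eventuallyEq
          (d2.div (d1.pow (g + 1)) (pow_ne_zero _ hne)) ?_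
        filter_upwards [hop] with t ht
        obtain ⟨r, h1, -, -, h2⟩ := hcc t ht
        rw [h1, h, h2]; rfl

/-- `X` is a Riemann surface. -/
instance : IsManifold 𝓘(ℂ) ω (HyperellipticCurve E) := by
  apply isManifold_of_contDiffOn
  rintro _ _ ⟨P, rfl⟩ ⟨Q, rfl⟩
  have := (transition_differentiableOn P Q).contDiffOn (n := ω)
    ((chart P).symm.trans (chart Q)).open_source
  simpa using this

noncomputable instance : MeasurableSpace (HyperellipticCurve E) := borel _

instance : BorelSpace (HyperellipticCurve E) := ⟨rfl⟩

/-- The hyperelliptic involution, `(x, y) ↦ (x, -y)` on `C₀` and `(z, w) ↦ (z, -w)` on `C₀'`. -/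
def involution : HyperellipticCurve E → HyperellipticCurve E
  | affine x y hy => affine x (-y) (by rw [neg_sq, hy])
  | infinity w hw => infinity (-w) (by rw [neg_sq, hw])

/-- The coordinate function `x` on `C₀` (with value `0` outside `C₀`). -/
def xCoord : HyperellipticCurve E → ℂ
  | affine x _ _ => x
  | infinity _ _ => 0

/-- The coordinate function `y` on `C₀` (with value `0` outside `C₀`). -/
def yCoord : HyperellipticCurve E → ℂ
  | affine _ y _ => y
  | infinity _ _ => 0

/-- The coordinate function `z = 1 / x` on `C₀'` (with value `0` outside `C₀'`). -/
noncomputable def zCoord : HyperellipticCurve E → ℂ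
  | affine x _ _ => x⁻¹
  | infinity _ _ => 0

/-- The coordinate function `w = y / x ^ (g + 1)` on `C₀'` (with value `0` outside `C₀'`). -/
noncomputable def wCoord : HyperellipticCurve E → ℂ
  | affine x y _ => y / x ^ (g + 1)
  | infinity w _ => w

/-- The holomorphic one-form `x ^ i * dx / y`, for `i < g`, as a linear form on each tangent space.
At the points where `y = 0` it is written through `2 * y * dy = f' x * dx`, and at the points at
infinity through `x ^ i * dx / y = - z ^ (g - 1 - i) * dz / w` and `2 * w * dw = h' z * dz`. -/
noncomputable def holomorphicForm (i : ℕ) :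
    (P : HyperellipticCurve E) → TangentSpace 𝓘(ℂ) P →L[ℂ] ℂ := open scoped Classical in fun
  | affine x y hy =>
    if y = 0 then (2 * x ^ i / E.f.derivative.eval x) •
      mfderiv 𝓘(ℂ) 𝓘(ℂ) (yCoord (E := E)) (affine x y hy)
    else (x ^ i / y) • mfderiv 𝓘(ℂ) 𝓘(ℂ) (xCoord (E := E)) (affine x y hy)
  | infinity w hw =>
    if w = 0 then (-2 * 0 ^ (g - 1 - i) / E.h.derivative.eval 0) •
      mfderiv 𝓘(ℂ) 𝓘(ℂ) (wCoord (E := E)) (infinity w hw)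
    else (-(0 ^ (g - 1 - i) / w)) •
      mfderiv 𝓘(ℂ) 𝓘(ℂ) (zCoord (E := E)) (infinity w hw)

/-- The conformal factor `ρ` of the canonical metric `ds² = ∑ ωᵢ ⊗ conj ωᵢ`, with
`ωᵢ = x ^ i * dx / y` for `0 ≤ i < g`: in the holomorphic chart `e`, with coordinate `ζ`, it is the
function with `ds² = ρ(ζ) dζ ⊗ conj dζ`. -/
noncomputable def conformalFactor (e : OpenPartialHomeomorph (HyperellipticCurve E) ℂ) (ζ : ℂ) :
    ℝ :=
  ∑ i ∈ Finset.range g,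
    ‖holomorphicForm i (e.symm ζ) (mfderiv 𝓘(ℂ) 𝓘(ℂ) e.symm ζ (1 : ℂ))‖ ^ 2

/-- The volume measure `dν` of the canonical metric: the smallest measure that dominates, for each
chart `e`, the local area measure `ρ(ζ) dλ(ζ)` (`λ` being Lebesgue measure) carried to `X`. As these
local measures agree on overlaps, it restricts to each of them. -/
noncomputable def area : Measure (HyperellipticCurve E) :=
  ⨆ e ∈ atlas ℂ (HyperellipticCurve E),
    (((volume : Measure ℂ).restrict e.target).withDensity
      fun ζ => ENNReal.ofReal (conformalFactor e ζ)).map e.symm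

/-- The Laplace-Beltrami operator of the canonical metric, `(1 / ρ) * (∂²/∂s² + ∂²/∂t²)` in a
holomorphic coordinate `ζ = s + i * t`. -/
noncomputable def laplaceBeltrami (φ : HyperellipticCurve E → ℂ) (P : HyperellipticCurve E) : ℂ :=
  Laplacian.laplacian (φ ∘ (chartAt ℂ P).symm) (chartAt ℂ P P) /
    (conformalFactor (chartAt ℂ P) (chartAt ℂ P P) : ℂ)

variable (E) in
/-- The complex vector space of smooth functions `X → ℂ`, as a subspace of all functions. -/
def smoothFunctions : Submodule ℂ (HyperellipticCurve E → ℂ) where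
  carrier := {φ | ContMDiff 𝓘(ℝ, ℂ) 𝓘(ℝ, ℂ) ∞ φ}
  add_mem' h₁ h₂ := h₁.add h₂
  zero_mem' := contMDiff_const
  smul_mem' c φ h := by
    have h₁ : ContMDiff 𝓘(ℝ, ℂ) 𝓘(ℝ, ℂ) ∞ fun z : ℂ => c * z :=
      (contDiff_const.mul contDiff_id).contMDiff
    exact h₁.comp h

variable (E) in
/-- The space `C^∞(X, ℂ)`. -/
def SmoothFunction : Type := smoothFunctions E

namespace SmoothFunction

noncomputable instance : AddCommGroup (SmoothFunction E) :=
  inferInstanceAs (AddCommGroup (smoothFunctions E))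

noncomputable instance : Module ℂ (SmoothFunction E) :=
  inferInstanceAs (Module ℂ (smoothFunctions E))

instance : CoeFun (SmoothFunction E) fun _ => HyperellipticCurve E → ℂ := ⟨fun φ => φ.1⟩

/-- The partial derivatives of order `k` of `φ` in the chart `chartAt ℂ P`. -/
noncomputable def derivInChart (P : HyperellipticCurve E) (k : ℕ) (φ : SmoothFunction E) :
    ℂ → ContinuousMultilinearMap ℝ (fun _ : Fin k => ℂ) ℂ :=
  iteratedFDeriv ℝ k (φ ∘ (chartAt ℂ P).symm)

/-- The Fréchet topology of `C^∞(X, ℂ)`: uniform convergence of the derivatives of each order in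
charts, on compact subsets of the domains of the charts. -/
noncomputable instance : TopologicalSpace (SmoothFunction E) :=
  ⨅ (P : HyperellipticCurve E) (k : ℕ),
    TopologicalSpace.induced
      (fun φ => UniformOnFun.ofFun {K | IsCompact K ∧ K ⊆ (chartAt ℂ P).target}
        (derivInChart P k φ)) inferInstance

theorem continuous_eval (P : HyperellipticCurve E) : Continuous fun φ : SmoothFunction E => φ P := by
  have h₁ : Continuous fun φ : SmoothFunction E =>
      UniformOnFun.ofFun {K | IsCompact K ∧ K ⊆ (chartAt ℂ P).target} (derivInChart P 0 φ) :=
    continuous_iff_le_induced.2 (iInf₂_le P 0)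
  have h₂ : Continuous fun φ : SmoothFunction E => derivInChart P 0 φ (chartAt ℂ P P) :=
    (UniformOnFun.uniformContinuous_eval_of_mem _ _ (mem_singleton (chartAt ℂ P P))
      (show _ ∧ _ from ⟨isCompact_singleton,
        singleton_subset_iff.2 (mem_chart_target ℂ P)⟩)).continuous.comp h₁
  have h₃ : Continuous fun φ : SmoothFunction E =>
      derivInChart P 0 φ (chartAt ℂ P P) (0 : Fin 0 → ℂ) :=
    (ContinuousMultilinearMap.apply ℝ (fun _ : Fin 0 => ℂ) ℂ (0 : Fin 0 → ℂ)).continuous.comp h₂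
  refine h₃.congr fun φ => ?_
  simp [derivInChart]

end SmoothFunction

variable (E) in
/-- The distributions on `X`, i.e. the continuous linear functionals on `C^∞(X, ℂ)`. -/
abbrev Distribution : Type := SmoothFunction E →L[ℂ] ℂ

/-- The Dirac distribution `δ_P`. -/
noncomputable def dirac (P : HyperellipticCurve E) : SmoothFunction E →L[ℂ] ℂ where
  toFun φ := φ P
  map_add' _ _ := rfl
  map_smul' _ _ := rfl
  cont := SmoothFunction.continuous_eval P

variable (E) in
/-- The group `Div(X)`. -/
abbrev Divisor : Type := HyperellipticCurve E →₀ ℤ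

namespace Divisor

/-- The degree of a divisor. -/
def deg (D : Divisor E) : ℤ := D.sum fun _ n => n

/-- The extension of the hyperelliptic involution to `Div(X)`. -/
noncomputable def involution (D : Divisor E) : Divisor E :=
  D.mapDomain HyperellipticCurve.involution

/-- The distribution `δ_D = ∑ n_P δ_P` of a divisor `D = ∑ n_P P`. -/
noncomputable def dirac (D : Divisor E) : Distribution E :=
  D.sum fun P n => n • HyperellipticCurve.dirac P

end Divisor

/-- `(σ_g(t) * (1 + t)²) ^ (1 / (2 * g + 2))`, where `σ_g(t) = 1 + t + ⋯ + t ^ (g - 1)`. -/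
noncomputable def normalizer (g : ℕ) (t : ℝ) : ℝ :=
  ((∑ i ∈ Finset.range g, t ^ i) * (1 + t) ^ 2) ^ (1 / (2 * (g : ℝ) + 2))

/-- The function `F_P`, as `pointFunction P Q = F_P(Q)`. -/
noncomputable def pointFunction : HyperellipticCurve E → HyperellipticCurve E → ℝ
  | affine a _ _, affine x _ _ => ‖x - a‖ / normalizer g (‖x‖ ^ 2)
  | affine a _ _, infinity _ _ => ‖1 - 0 * a‖ / normalizer g (‖(0 : ℂ)‖ ^ 2)
  | infinity _ _, affine x _ _ => 1 / normalizer g (‖x‖ ^ 2)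
  | infinity _ _, infinity _ _ => ‖(0 : ℂ)‖ / normalizer g (‖(0 : ℂ)‖ ^ 2)

theorem normalizer_inv (hg : 1 ≤ g) {z : ℂ} (hz : z ≠ 0) :
    normalizer g (‖z‖ ^ 2) = ‖z‖ * normalizer g (‖z⁻¹‖ ^ 2) := by
  have hn : 0 < ‖z‖ := norm_pos_iff.2 hz
  obtain ⟨k, rfl⟩ : ∃ k, g = k + 1 := ⟨g - 1, by omega⟩
  have h₁ : ‖z‖ = (‖z‖ ^ (2 * (k + 1) + 2)) ^ (1 / (2 * ((k + 1 : ℕ) : ℝ) + 2)) := by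
    rw [← Real.rpow_natCast, ← Real.rpow_mul hn.le]
    push_cast
    rw [mul_one_div_cancel (by positivity), Real.rpow_one]
  unfold normalizer
  conv_rhs => rw [h₁]
  rw [← Real.mul_rpow (by positivity) (by positivity)]
  congr 1
  rw [norm_inv, ← Finset.sum_range_reflect, Finset.sum_mul, Finset.sum_mul, Finset.mul_sum]
  refine Finset.sum_congr rfl fun i hi => ?_
  have hi' : i ≤ k := by simpa [Nat.lt_succ_iff] using hi
  obtain ⟨j, rfl⟩ := Nat.exists_eq_add_of_le hi'
  have : i + j + 1 - 1 - i = j := by omega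
  rw [this]
  simp only [inv_pow]
  field_simp
  ring

/-- The expression of `F_P` on `C₀'`. -/
theorem pointFunction_affine_ofInfinity (hg : 1 ≤ g) (a b : ℂ) (h : b ^ 2 = E.f.eval a)
    (r : AffineCurve E.h) :
    pointFunction (affine a b h) (ofInfinity r) = ‖1 - r.1.1 * a‖ / normalizer g (‖r.1.1‖ ^ 2) := by
  unfold ofInfinity
  split_ifs with hz
  · simp only [pointFunction, hz]
  · have hn : 0 < ‖r.1.1‖ := norm_pos_iff.2 hz
    have h₁ : 1 - r.1.1 * a = r.1.1 * (r.1.1⁻¹ - a) := by field_simp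
    simp only [pointFunction]
    rw [normalizer_inv hg hz, h₁, norm_mul, mul_div_mul_left _ _ hn.ne']

theorem pointFunction_infinity_ofInfinity (hg : 1 ≤ g) (b : ℂ) (h : b ^ 2 = E.h.eval 0)
    (r : AffineCurve E.h) :
    pointFunction (infinity b h) (ofInfinity r) = ‖r.1.1‖ / normalizer g (‖r.1.1‖ ^ 2) := by
  unfold ofInfinity
  split_ifs with hz
  · simp only [pointFunction, hz]
  · have hn : 0 < ‖r.1.1‖ := norm_pos_iff.2 hz
    simp only [pointFunction]
    rw [normalizer_inv hg hz, ← mul_div_mul_left _ _ hn.ne', mul_one]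

/-- The function `F_D = ∏ F_P ^ n_P` of a divisor `D = ∑ n_P P`. -/
noncomputable def Divisor.F (D : Divisor E) (Q : HyperellipticCurve E) : ℝ :=
  D.prod fun P n => pointFunction P Q ^ n

/-- The function `u_D = log F_D`. -/
noncomputable def Divisor.u (D : Divisor E) (Q : HyperellipticCurve E) : ℝ := Real.log (D.F Q)

/-- `ψ` is a holomorphic coordinate of `X` near `Q`, centred at `Q`. -/
def IsCentredCoordinate (ψ : OpenPartialHomeomorph (HyperellipticCurve E) ℂ)
    (Q : HyperellipticCurve E) : Prop :=
  ψ ∈ IsManifold.maximalAtlas 𝓘(ℂ) ω (HyperellipticCurve E) ∧ Q ∈ ψ.source ∧ ψ Q = 0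

/-- The coordinate disc `{|ψ| ≤ ε}`. -/
def coordinateDisc (ψ : OpenPartialHomeomorph (HyperellipticCurve E) ℂ) (ε : ℝ) :
    Set (HyperellipticCurve E) :=
  {R ∈ ψ.source | ‖ψ R‖ ≤ ε}

/-- `Δu = T` as distributions, for a function `u` that is smooth outside the finite set `S`: for
every test function `φ`, the function `u * Δφ` is integrable with respect to `dν`, and its integral
over the complement of the coordinate discs of radius `ε` about the points of `S` (for any choice of
centred holomorphic coordinates) tends to `T φ` as `ε → 0+`. -/
def HasLaplacian (u : HyperellipticCurve E → ℝ) (S : Finset (HyperellipticCurve E))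
    (T : Distribution E) : Prop :=
  ∀ φ : SmoothFunction E,
    Integrable (fun R => (u R : ℂ) * laplaceBeltrami φ R) area ∧
    ∀ ψ : HyperellipticCurve E → OpenPartialHomeomorph (HyperellipticCurve E) ℂ,
      (∀ Q ∈ S, IsCentredCoordinate (ψ Q) Q) →
      Tendsto
        (fun ε : ℝ => ∫ R in (⋃ Q ∈ S, coordinateDisc (ψ Q) ε)ᶜ,
          (u R : ℂ) * laplaceBeltrami φ R ∂area)
        (𝓝[>] 0) (𝓝 (T φ))

end HyperellipticCurve

/-!
Since `D` has degree zero, the factors `N` cancel in `F_D`, and `u_D = log |r|` almost everywhere,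
for the meromorphic function `r = ∏ (x - x(P)) ^ n_P` (over the points `P` of `D` in `C₀`). In the
chart at a point `Q` this exhibits `u_D` as `∑ n_P log |G_P|` with `G_P` holomorphic, and the order
of `G_P` at `Q` is the multiplicity of `Q` in `P + ι(P)` (`AffineCurve.analyticOrderAt_x_sub`,
`HyperellipticCurve.exists_pointFunction_eq`).

The analysis takes place in the plane. The function `log ‖z‖` is `2π` times a fundamental solution
of the Laplacian (`integral_log_norm_mul_laplacian`): Green's identity is applied to the smooth
functions `log (‖z‖² + ε²) / 2`, whose Laplacians `2 ε² / (‖z‖² + ε²)²` concentrate at the origin.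
Near a zero of order `n` of a holomorphic function `G`, the function `log |G|` differs from `n log
‖z - z₀‖` by a harmonic function, so its Laplacian is `2π n` times the Dirac mass
(`AnalyticAt.eventually_integral_log_norm_mul_laplacian`).

For a test function `φ` supported in a chart, the integral of `u_D Δφ` over `X` is an integral of
the Euclidean Laplacian over the plane (`HyperellipticCurve.integral_mul_laplaceBeltrami`), because
the measure `area` is `ρ dλ` in each chart (`HyperellipticCurve.map_comap_area`) and the Laplacian
is conformally covariant (`laplacian_comp_analyticAt`). Only the points with `y ≠ 0` matter here,
as the others form a finite set; there the metric is `∑ |xⁱ / y|² |dx|²`, which gives the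
measurability and the positivity of `ρ`. A partition of unity extends the identity to all test
functions. Finally, `u_D Δφ` is integrable and the coordinate discs shrink to points, so the
integrals over the complements of the discs tend to the integral over `X`.
-/

open scoped Laplacian

/-! ### Distributional Laplacians in the plane -/

/-- In polar coordinates, this is the continuity of `r * log r` at `0`. -/
theorem locallyIntegrable_log_norm : LocallyIntegrable (fun z : ℂ => Real.log ‖z‖) := by
  rw [locallyIntegrable_iff]
  intro K hK
  obtain ⟨R, hR⟩ := hK.isBounded.subset_closedBall (0 : ℂ)
  have h : Integrable (fun z : ℂ => (Iic R).indicator Real.log ‖z‖) := by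
    rw [integrable_fun_norm_addHaar volume (f := (Iic R).indicator Real.log)]
    have h₁ : IntegrableOn (fun y : ℝ => y * Real.log y) (Icc 0 R) :=
      Real.continuous_mul_log.continuousOn.integrableOn_Icc
    have h₂ : (fun y : ℝ => y ^ (Module.finrank ℝ ℂ - 1) • (Iic R).indicator Real.log y) =
        (Iic R).indicator fun y => y * Real.log y := by
      ext y
      by_cases hy : y ∈ Iic R <;> simp [hy]
    rw [h₂, IntegrableOn, integrable_indicator_iff measurableSet_Iic, IntegrableOn,
      Measure.restrict_restrict measurableSet_Iic]
    exact h₁.mono_set fun y hy => ⟨le_of_lt hy.2, hy.1⟩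
  refine (h.integrableOn (s := K)).congr_fun (fun z hz => ?_) hK.measurableSet
  have : ‖z‖ ∈ Iic R := by simpa using hR hz
  simp [this]

theorem ContDiffAt.laplacian {f : ℂ → ℂ} {z : ℂ} (hf : ContDiffAt ℝ ∞ f z) :
    ContDiffAt ℝ ∞ (Δ f) z := by
  rw [InnerProductSpace.laplacian_eq_iteratedFDeriv_complexPlane]
  have h : ContDiffAt ℝ ∞ (iteratedFDeriv ℝ 2 f) z :=
    hf.iteratedFDeriv_right (m := ∞) (i := 2) (by decide)
  have h' (v : Fin 2 → ℂ) : ContDiffAt ℝ ∞ (fun x => iteratedFDeriv ℝ 2 f x v) z :=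
    (ContinuousMultilinearMap.apply ℝ (fun _ : Fin 2 => ℂ) ℂ v).contDiff.contDiffAt.comp z h
  exact (h' _).add (h' _)

theorem ContDiff.laplacian {f : ℂ → ℂ} (hf : ContDiff ℝ ∞ f) : ContDiff ℝ ∞ (Δ f) :=
  contDiff_iff_contDiffAt.2 fun z => (hf.contDiffAt (x := z)).laplacian

theorem laplacian_eq_zero_of_notMem_tsupport {f : ℂ → ℂ} {z : ℂ} (hz : z ∉ tsupport f) :
    Δ f z = 0 := by
  have h : f =ᶠ[𝓝 z] fun _ => 0 := notMem_tsupport_iff_eventuallyEq.1 hz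
  rw [(InnerProductSpace.laplacian_congr_nhds h).eq_of_nhds]
  simp

theorem HasCompactSupport.laplacian {f : ℂ → ℂ} (hf : HasCompactSupport f) :
    HasCompactSupport (Δ f) :=
  HasCompactSupport.of_support_subset_isCompact hf fun z hz => by
    by_contra h
    exact hz (laplacian_eq_zero_of_notMem_tsupport h)

/-- Green's second identity, for a function that is smooth near the support of the test
function. -/
theorem integral_mul_laplacian {f ψ : ℂ → ℂ} {U : Set ℂ} (hU : IsOpen U)
    (hf : ContDiffOn ℝ ∞ f U) (hψ : ContDiff ℝ ∞ ψ) (hc : HasCompactSupport ψ)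
    (hψU : tsupport ψ ⊆ U) :
    ∫ z, f z * Δ ψ z = ∫ z, Δ f z * ψ z := by
  -- a cutoff `χ`, equal to `1` near the support of `ψ`, makes `f` a test function on the plane
  obtain ⟨V, hVo, hKV, hVU, hVc⟩ := exists_open_between_and_isCompact_closure hc.isCompact
    hU hψU
  obtain ⟨χ, h₁, h₀, -⟩ := exists_contMDiffMap_one_nhds_of_subset_interior 𝓘(ℝ, ℂ) (n := ⊤)
    (isClosed_tsupport ψ) (hKV.trans hVo.interior_eq.ge)
  have hχ : ContDiff ℝ ∞ χ := χ.contMDiff.contDiff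
  have hχs : tsupport χ ⊆ closure V := closure_mono fun z hz => by
    by_contra h
    exact hz (h₀ z h)
  have hF : ContDiff ℝ ∞ fun z => (χ z : ℂ) * f z := by
    refine contDiff_iff_contDiffAt.2 fun z => ?_
    by_cases hz : z ∈ U
    · exact (Complex.ofRealCLM.contDiff.comp hχ).contDiffAt.mul (hf.contDiffAt (hU.mem_nhds hz))
    · have : (χ : ℂ → ℝ) =ᶠ[𝓝 z] 0 :=
        notMem_tsupport_iff_eventuallyEq.1 fun h => hz (hVU (hχs h))
      refine (contDiffAt_const (c := (0 : ℂ))).congr_of_eventuallyEq ?_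
      filter_upwards [this] with w hw
      simp [hw]
  have hFc : HasCompactSupport fun z => (χ z : ℂ) * f z := by
    refine HasCompactSupport.of_support_subset_isCompact hVc fun z hz => hχs (subset_tsupport _ ?_)
    intro h
    exact hz (by simp [h])
  have key := SchwartzMap.integral_mul_laplacian_right_eq_left (μ := (volume : Measure ℂ))
    (hFc.toSchwartzMap hF) (hc.toSchwartzMap hψ)
  simp only [SchwartzMap.laplacian_apply] at key
  change ∫ z, ((χ z : ℂ) * f z) * Δ ψ z = ∫ z, Δ (fun z => (χ z : ℂ) * f z) z * ψ z at key
  have hnear : ∀ z ∈ tsupport ψ, (fun z => (χ z : ℂ) * f z) =ᶠ[𝓝 z] f := fun z hz => by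
    filter_upwards [h₁.filter_mono (nhds_le_nhdsSet hz)] with w hw
    simp [hw]
  convert key using 1
  · refine integral_congr_ae (Eventually.of_forall fun z => ?_)
    by_cases hz : z ∈ tsupport ψ
    · exact congrArg (· * Δ ψ z) (hnear z hz).eq_of_nhds.symm
    · simp [laplacian_eq_zero_of_notMem_tsupport hz]
  · refine integral_congr_ae (Eventually.of_forall fun z => ?_)
    by_cases hz : z ∈ tsupport ψ
    · simp only
      rw [(InnerProductSpace.laplacian_congr_nhds (hnear z hz)).eq_of_nhds]
    · simp [image_eq_zero_of_notMem_tsupport hz]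

theorem hasFDerivAt_log_norm_sq_add {ε : ℝ} (hε : 0 < ε) (z : ℂ) :
    HasFDerivAt (fun z : ℂ => Real.log (‖z‖ ^ 2 + ε ^ 2) / 2)
      ((‖z‖ ^ 2 + ε ^ 2)⁻¹ • innerSL ℝ z) z := by
  have hq : ‖z‖ ^ 2 + ε ^ 2 ≠ 0 := by positivity
  have h := (((hasStrictFDerivAt_norm_sq z).hasFDerivAt.add_const (ε ^ 2)).log hq).mul_const
    (2⁻¹ : ℝ)
  simp only [div_eq_mul_inv]
  refine h.congr_fderiv (ContinuousLinearMap.ext fun v => Eq.symm ?_)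
  change (‖z‖ ^ 2 + ε ^ 2)⁻¹ * inner ℝ z v =
    2⁻¹ * ((‖z‖ ^ 2 + ε ^ 2)⁻¹ * (2 • inner ℝ z v))
  rw [nsmul_eq_mul]
  push_cast
  ring

theorem laplacian_log_norm_sq_add {ε : ℝ} (hε : 0 < ε) (z : ℂ) :
    Δ (fun z : ℂ => Real.log (‖z‖ ^ 2 + ε ^ 2) / 2) z = 2 * ε ^ 2 / (‖z‖ ^ 2 + ε ^ 2) ^ 2 := by
  have hq : ‖z‖ ^ 2 + ε ^ 2 ≠ 0 := by positivity
  have h₁ : fderiv ℝ (fun z : ℂ => Real.log (‖z‖ ^ 2 + ε ^ 2) / 2) =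
      fun z => (‖z‖ ^ 2 + ε ^ 2)⁻¹ • innerSL ℝ z :=
    funext fun z => (hasFDerivAt_log_norm_sq_add hε z).fderiv
  have h₂ := ((hasDerivAt_inv hq).comp_hasFDerivAt z
    ((hasStrictFDerivAt_norm_sq z).hasFDerivAt.add_const (ε ^ 2))).smul
    (innerSL ℝ (E := ℂ)).hasFDerivAt
  have h₃ (v : ℂ) : iteratedFDeriv ℝ 2 (fun z : ℂ => Real.log (‖z‖ ^ 2 + ε ^ 2) / 2) z ![v, v] =
      (‖z‖ ^ 2 + ε ^ 2)⁻¹ * ‖v‖ ^ 2 -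
        2 * (inner ℝ z v) ^ 2 / (‖z‖ ^ 2 + ε ^ 2) ^ 2 := by
    rw [iteratedFDeriv_two_apply, h₁]
    simp only [Function.comp_def] at h₂
    erw [h₂.fderiv]
    change (‖z‖ ^ 2 + ε ^ 2)⁻¹ * inner ℝ v v +
      -((‖z‖ ^ 2 + ε ^ 2) ^ 2)⁻¹ * (2 • inner ℝ z v) * inner ℝ z v = _
    rw [nsmul_eq_mul, real_inner_self_eq_norm_sq]
    push_cast
    ring
  rw [InnerProductSpace.laplacian_eq_iteratedFDeriv_complexPlane]
  simp only [h₃]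
  have h₄ : ‖z‖ ^ 2 = z.re ^ 2 + z.im ^ 2 := by
    rw [Complex.sq_norm, Complex.normSq_apply]; ring
  simp
  field_simp
  rw [h₄]
  ring

theorem integral_inv_one_add_norm_sq_sq :
    Integrable (fun w : ℂ => 2 / (‖w‖ ^ 2 + 1) ^ 2) ∧
      ∫ w : ℂ, 2 / (‖w‖ ^ 2 + 1) ^ 2 = 2 * Real.pi := by
  have hd (y : ℝ) : HasDerivAt (fun y : ℝ => -(y ^ 2 + 1)⁻¹) (y * (2 / (y ^ 2 + 1) ^ 2)) y := by
    have hq : y ^ 2 + 1 ≠ 0 := by positivity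
    have := (((hasDerivAt_pow 2 y).add_const 1).inv hq).neg
    refine this.congr_deriv ?_
    field_simp
    simp [mul_comm]
  have ht : Tendsto (fun y : ℝ => -(y ^ 2 + 1)⁻¹) atTop (𝓝 0) := by
    have : Tendsto (fun y : ℝ => y ^ 2 + 1) atTop atTop :=
      tendsto_atTop_add_const_right _ _ (tendsto_pow_atTop two_ne_zero)
    simpa using this.inv_tendsto_atTop.neg
  have hpos : ∀ y ∈ Ioi (0 : ℝ), 0 ≤ y * (2 / (y ^ 2 + 1) ^ 2) := fun y hy => by
    have : 0 < y := hy
    positivity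
  constructor
  · rw [integrable_fun_norm_addHaar volume (f := fun y : ℝ => 2 / (y ^ 2 + 1) ^ 2)]
    simpa using integrableOn_Ioi_deriv_of_nonneg' (fun y _ => hd y) hpos ht
  · rw [integral_fun_norm_addHaar volume (fun y : ℝ => 2 / (y ^ 2 + 1) ^ 2)]
    have h := integral_Ioi_of_hasDerivAt_of_nonneg' (fun y _ => hd y) hpos ht
    simp only [Complex.finrank_real_complex, Nat.add_one_sub_one, pow_one, smul_eq_mul]
    rw [h]
    simp [Measure.real, Complex.volume_ball]

/-- `(1 / 2π) log ‖z‖` is a fundamental solution of the Laplacian on the plane. -/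
theorem integral_log_norm_mul_laplacian {ψ : ℂ → ℂ} (hψ : ContDiff ℝ ∞ ψ)
    (hc : HasCompactSupport ψ) :
    ∫ z : ℂ, (Real.log ‖z‖ : ℂ) * Δ ψ z = 2 * Real.pi * ψ 0 := by
  have hΔc := hc.laplacian
  have hΔ := hψ.laplacian.continuous
  -- `log ‖z‖` is regularized to the smooth function `log (‖z‖ ^ 2 + ε ^ 2) / 2`
  have hsmooth {ε : ℝ} (hε : 0 < ε) :
      ContDiff ℝ ∞ fun z : ℂ => Real.log (‖z‖ ^ 2 + ε ^ 2) / 2 :=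
    (((contDiff_norm_sq ℝ).add contDiff_const).log fun z => by positivity).div_const 2
  have hsmooth' {ε : ℝ} (hε : 0 < ε) :
      ContDiff ℝ ∞ fun z : ℂ => ((Real.log (‖z‖ ^ 2 + ε ^ 2) / 2 : ℝ) : ℂ) :=
    Complex.ofRealCLM.contDiff.comp (hsmooth hε)
  have hlim₁ : Tendsto (fun ε : ℝ => ∫ z : ℂ, ((Real.log (‖z‖ ^ 2 + ε ^ 2) / 2 : ℝ) : ℂ) * Δ ψ z)
      (𝓝[>] 0) (𝓝 (∫ z : ℂ, (Real.log ‖z‖ : ℂ) * Δ ψ z)) := by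
    have hcont₁ : Continuous fun z : ℂ => Real.log (‖z‖ ^ 2 + 1 ^ 2) / 2 :=
      (hsmooth one_pos).continuous
    refine tendsto_integral_filter_of_dominated_convergence
      (fun z => |Real.log ‖z‖| * ‖Δ ψ z‖ + |Real.log (‖z‖ ^ 2 + 1 ^ 2) / 2| * ‖Δ ψ z‖) ?_ ?_ ?_ ?_
    · filter_upwards [self_mem_nhdsWithin] with ε hε
      exact ((hsmooth' hε).continuous.mul hΔ).aestronglyMeasurable
    · filter_upwards [Ioo_mem_nhdsGT one_pos] with ε hε
      have h0 : ∀ᵐ z : ℂ, z ≠ 0 := by simp [ae_iff]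
      filter_upwards [h0] with z hz
      rw [← add_mul, norm_mul, Complex.norm_real, Real.norm_eq_abs]
      refine mul_le_mul_of_nonneg_right ?_ (norm_nonneg _)
      have hz' : 0 < ‖z‖ := norm_pos_iff.2 hz
      have h₁ : Real.log ‖z‖ = Real.log (‖z‖ ^ 2) / 2 := by
        rw [Real.log_pow]; push_cast; ring
      have h₂ : Real.log (‖z‖ ^ 2) ≤ Real.log (‖z‖ ^ 2 + ε ^ 2) :=
        Real.log_le_log (by positivity) (by nlinarith [sq_nonneg ε])
      have h₃ : Real.log (‖z‖ ^ 2 + ε ^ 2) ≤ Real.log (‖z‖ ^ 2 + 1 ^ 2) :=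
        Real.log_le_log (by nlinarith [sq_nonneg ε]) (by nlinarith [hε.1, hε.2])
      rw [abs_le]
      constructor
      · linarith [neg_abs_le (Real.log ‖z‖), abs_nonneg (Real.log (‖z‖ ^ 2 + 1 ^ 2) / 2)]
      · have h₄ := le_abs_self (Real.log (‖z‖ ^ 2 + 1 ^ 2) / 2)
        have h₅ := abs_nonneg (Real.log ‖z‖)
        have h₆ := div_le_div_of_nonneg_right h₃ zero_le_two
        exact (h₆.trans h₄).trans (le_add_of_nonneg_left h₅)
    · have h₁ : Integrable fun z : ℂ => |Real.log ‖z‖| * ‖Δ ψ z‖ := by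
        simpa using (locallyIntegrable_log_norm.integrable_smul_right_of_hasCompactSupport
          hΔ.norm hΔc.norm).norm
      have h₂ : Integrable fun z : ℂ => |Real.log (‖z‖ ^ 2 + 1 ^ 2) / 2| * ‖Δ ψ z‖ :=
        (hcont₁.abs.mul hΔ.norm).integrable_of_hasCompactSupport hΔc.norm.mul_left
      exact h₁.add h₂
    · have h0 : ∀ᵐ z : ℂ, z ≠ 0 := by simp [ae_iff]
      filter_upwards [h0] with z hz
      have hz' : 0 < ‖z‖ := norm_pos_iff.2 hz
      refine Tendsto.mul_const _ (Complex.continuous_ofReal.continuousAt.tendsto.comp ?_)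
      have hca : ContinuousAt (fun ε : ℝ => Real.log (‖z‖ ^ 2 + ε ^ 2) / 2) 0 := by
        refine ContinuousAt.div_const (ContinuousAt.log (by fun_prop) ?_) 2
        positivity
      have := hca.tendsto
      have h₁ : Real.log (‖z‖ ^ 2 + 0 ^ 2) / 2 = Real.log ‖z‖ := by
        rw [zero_pow two_ne_zero, add_zero, Real.log_pow]; push_cast; ring
      rw [h₁] at this
      exact this.mono_left nhdsWithin_le_nhds
  have hgreen : ∀ ε ∈ Ioi (0 : ℝ), ∫ w : ℂ, ((2 / (‖w‖ ^ 2 + 1) ^ 2 : ℝ) : ℂ) * ψ (ε • w) =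
      ∫ z : ℂ, ((Real.log (‖z‖ ^ 2 + ε ^ 2) / 2 : ℝ) : ℂ) * Δ ψ z := fun ε hε => by
    have hε' : 0 < ε := hε
    -- Green's identity, and then the substitution `z = ε w`
    rw [integral_mul_laplacian isOpen_univ (hsmooth' hε).contDiffOn hψ hc (subset_univ _)]
    have h₁ (z : ℂ) : Δ (fun z : ℂ => ((Real.log (‖z‖ ^ 2 + ε ^ 2) / 2 : ℝ) : ℂ)) z =
        ((2 * ε ^ 2 / (‖z‖ ^ 2 + ε ^ 2) ^ 2 : ℝ) : ℂ) := by
      rw [← laplacian_log_norm_sq_add hε]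
      exact ((hsmooth hε).of_le (by decide)).contDiffAt.laplacian_CLM_comp_left
        (l := Complex.ofRealCLM)
    simp only [h₁]
    have h₂ := Measure.integral_comp_smul_of_nonneg (volume : Measure ℂ)
      (fun z : ℂ => ((2 * ε ^ 2 / (‖z‖ ^ 2 + ε ^ 2) ^ 2 : ℝ) : ℂ) * ψ z) ε (hR := hε'.le)
    rw [Complex.finrank_real_complex, eq_inv_smul_iff₀ (by positivity), ← integral_smul] at h₂
    rw [← h₂]
    refine integral_congr_ae (Eventually.of_forall fun w => ?_)
    simp only
    rw [Complex.real_smul (x := ε ^ 2), ← mul_assoc, ← Complex.ofReal_mul]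
    congr 2
    rw [norm_smul, Real.norm_of_nonneg hε'.le]
    field_simp
  have hlim₂ : Tendsto (fun ε : ℝ => ∫ w : ℂ, ((2 / (‖w‖ ^ 2 + 1) ^ 2 : ℝ) : ℂ) * ψ (ε • w))
      (𝓝[>] 0) (𝓝 (∫ w : ℂ, ((2 / (‖w‖ ^ 2 + 1) ^ 2 : ℝ) : ℂ) * ψ 0)) := by
    obtain ⟨C, hC⟩ := hψ.continuous.bounded_above_of_compact_support hc
    refine tendsto_integral_filter_of_dominated_convergence
      (fun w => 2 / (‖w‖ ^ 2 + 1) ^ 2 * C) ?_ ?_ ?_ ?_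
    · filter_upwards [self_mem_nhdsWithin] with ε hε
      refine Continuous.aestronglyMeasurable (Continuous.mul ?_ ?_)
      · exact Complex.continuous_ofReal.comp
          (continuous_const.div (by fun_prop) fun w => by positivity)
      · exact hψ.continuous.comp (by fun_prop)
    · refine Eventually.of_forall fun ε => Eventually.of_forall fun w => ?_
      rw [norm_mul, Complex.norm_real, Real.norm_of_nonneg (by positivity)]
      exact mul_le_mul_of_nonneg_left (hC _) (by positivity)
    · exact integral_inv_one_add_norm_sq_sq.1.mul_const C
    · refine Eventually.of_forall fun w => Tendsto.const_mul _ ?_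
      have : ContinuousAt (fun ε : ℝ => ψ (ε • w)) 0 :=
        (hψ.continuous.comp (by fun_prop)).continuousAt
      have := this.tendsto
      rw [zero_smul] at this
      exact this.mono_left nhdsWithin_le_nhds
  refine tendsto_nhds_unique hlim₁ ((hlim₂.congr' ?_).trans_eq ?_)
  · filter_upwards [self_mem_nhdsWithin] with ε hε using hgreen ε hε
  · rw [integral_mul_const, integral_complex_ofReal, integral_inv_one_add_norm_sq_sq.2]
    push_cast
    rfl

/-- The Laplacian is conformally covariant: `Δ (F ∘ T) = |T'| ^ 2 • (Δ F) ∘ T` for holomorphic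
`T`. -/
theorem laplacian_comp_analyticAt {F T : ℂ → ℂ} {z : ℂ} (hF : ContDiffAt ℝ 2 F (T z))
    (hT : AnalyticAt ℂ T z) : Δ (F ∘ T) z = (‖deriv T z‖ ^ 2 : ℝ) • Δ F (T z) := by
  have hT₁ : ∀ᶠ w in 𝓝 z, HasDerivAt T (deriv T w) w := by
    filter_upwards [hT.eventually_analyticAt] with w hw using hw.differentiableAt.hasDerivAt
  have hF₁ : ∀ᶠ w in 𝓝 z, DifferentiableAt ℝ F (T w) := by
    have := hT.continuousAt.eventually (hF.eventually (by simp))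
    filter_upwards [this] with w hw using hw.differentiableAt two_ne_zero
  have hT' : HasDerivAt (deriv T) (deriv (deriv T) z) z := hT.deriv.differentiableAt.hasDerivAt
  have hd : ∀ᶠ w in 𝓝 z, ∀ v, fderiv ℝ (F ∘ T) w v = fderiv ℝ F (T w) (deriv T w * v) := by
    filter_upwards [hT₁, hF₁] with w h₁ h₂ v
    have h₃ := h₂.hasFDerivAt.comp w (h₁.hasFDerivAt.restrictScalars ℝ)
    rw [h₃.fderiv]
    simp [mul_comm]
  have hF' : HasFDerivAt (fderiv ℝ F) (fderiv ℝ (fderiv ℝ F) (T z)) (T z) :=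
    ((hF.fderiv_right (m := 1) (by norm_num)).differentiableAt one_ne_zero).hasFDerivAt
  have hFT : ContDiffAt ℝ 2 (F ∘ T) z := hF.comp z (hT.contDiffAt.restrict_scalars ℝ)
  have hFT' : HasFDerivAt (fderiv ℝ (F ∘ T)) (fderiv ℝ (fderiv ℝ (F ∘ T)) z) z :=
    ((hFT.fderiv_right (m := 1) (by norm_num)).differentiableAt one_ne_zero).hasFDerivAt
  have key (v : ℂ) : iteratedFDeriv ℝ 2 (F ∘ T) z ![v, v] =
      fderiv ℝ (fderiv ℝ F) (T z) (deriv T z * v) (deriv T z * v) +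
        fderiv ℝ F (T z) (deriv (deriv T) z * v * v) := by
    have h₁ := hFT'.clm_apply (hasFDerivAt_const v z)
    have h₂ := (hF'.comp z
      (hT.differentiableAt.hasDerivAt.hasFDerivAt.restrictScalars ℝ)).clm_apply
      ((hT'.mul_const v).hasFDerivAt.restrictScalars ℝ)
    have h₃ := h₁.unique (h₂.congr_of_eventuallyEq (by
      filter_upwards [hd] with w hw using hw v))
    have h₄ := congrArg (fun L => L v) h₃
    rw [iteratedFDeriv_two_apply]
    simp at h₄ ⊢
    rw [h₄, add_comm]
    congr 2 <;> ring_nf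
  -- the trace of the Hessian of `F` over the orthogonal vectors `a` and `a * I`
  have hS : ∀ a : ℂ, fderiv ℝ (fderiv ℝ F) (T z) a a +
      fderiv ℝ (fderiv ℝ F) (T z) (a * Complex.I) (a * Complex.I) =
      (‖a‖ ^ 2 : ℝ) • (fderiv ℝ (fderiv ℝ F) (T z) 1 1 +
        fderiv ℝ (fderiv ℝ F) (T z) Complex.I Complex.I) := by
    intro a
    set B := fderiv ℝ (fderiv ℝ F) (T z)
    have ha : a = a.re • (1 : ℂ) + a.im • Complex.I := by
      simp [Complex.re_add_im]
    have ha' : a * Complex.I = (-a.im) • (1 : ℂ) + a.re • Complex.I := by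
      apply Complex.ext <;> simp
    have h₄ : ‖a‖ ^ 2 = a.re ^ 2 + a.im ^ 2 := by
      rw [Complex.sq_norm, Complex.normSq_apply]; ring
    rw [ha', h₄]
    nth_rewrite 1 2 [ha]
    simp only [map_add, map_smul, add_apply, smul_apply]
    module
  rw [InnerProductSpace.laplacian_eq_iteratedFDeriv_complexPlane,
    InnerProductSpace.laplacian_eq_iteratedFDeriv_complexPlane]
  simp only [key, iteratedFDeriv_two_apply (𝕜 := ℝ) F]
  -- the terms with `T''` cancel, since `1 ^ 2 + I ^ 2 = 0`
  have hI : deriv (deriv T) z * Complex.I * Complex.I = -(deriv (deriv T) z * 1 * 1) := by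
    rw [mul_assoc, Complex.I_mul_I]; ring
  rw [hI, map_neg]
  simp only [Matrix.cons_val_zero, Matrix.cons_val_one]
  rw [← hS, mul_one]
  ring

/-- Near a zero of order `n` of a holomorphic function `G`, the distributional Laplacian of
`log ‖G‖` is `2π n` times the Dirac mass at that zero. -/
theorem AnalyticAt.eventually_integral_log_norm_mul_laplacian {G : ℂ → ℂ} {z₀ : ℂ} {n : ℕ}
    (hG : AnalyticAt ℂ G z₀) (hn : analyticOrderAt G z₀ = n) :
    ∀ᶠ V in (𝓝 z₀).smallSets, ∀ ψ : ℂ → ℂ, ContDiff ℝ ∞ ψ → HasCompactSupport ψ →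
      tsupport ψ ⊆ V → Integrable (fun z => (Real.log ‖G z‖ : ℂ) * Δ ψ z) ∧
        ∫ z, (Real.log ‖G z‖ : ℂ) * Δ ψ z = 2 * Real.pi * n * ψ z₀ := by
  obtain ⟨h, hh, h0, hGh⟩ := hG.analyticOrderAt_eq_natCast.1 hn
  have hW : ∀ᶠ z in 𝓝 z₀, AnalyticAt ℂ h z ∧ h z ≠ 0 ∧ G z = (z - z₀) ^ n • h z :=
    hh.eventually_analyticAt.and ((hh.continuousAt.eventually_ne h0).and hGh)
  obtain ⟨W, hW, hWo, hzW⟩ := eventually_nhds_iff.1 hW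
  filter_upwards [eventually_smallSets_subset.2 (hWo.mem_nhds hzW)] with V hV ψ hψ hc hs
  have hsW := hs.trans hV
  have hΔ := hψ.laplacian.continuous
  have hΔc := hc.laplacian
  have hsm : ContDiffOn ℝ ∞ (fun z => Real.log ‖h z‖) W := fun z hz => by
    have h₁ : ContDiffAt ℝ ∞ h z := ((hW z hz).1.contDiffAt (n := ∞)).restrict_scalars ℝ
    exact ((h₁.norm ℝ (hW z hz).2.1).log (norm_ne_zero_iff.2 (hW z hz).2.1)).contDiffWithinAt
  have hsm' : ContDiffOn ℝ ∞ (fun z => (Real.log ‖h z‖ : ℂ)) W :=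
    Complex.ofRealCLM.contDiff.comp_contDiffOn hsm
  have e₁ : (fun z => (Real.log ‖G z‖ : ℂ) * Δ ψ z) =ᵐ[volume]
      fun z => n * ((Real.log ‖z - z₀‖ : ℂ) * Δ ψ z) + (Real.log ‖h z‖ : ℂ) * Δ ψ z := by
    have hne : ∀ᵐ z : ℂ, z ≠ z₀ := by simp [ae_iff]
    filter_upwards [hne] with z hz
    by_cases hzs : z ∈ tsupport ψ
    · have := hW z (hsW hzs)
      rw [this.2.2, norm_smul, Real.log_mul (by simp [sub_ne_zero.2 hz]) (by simp [this.2.1]),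
        norm_pow, Real.log_pow]
      push_cast
      ring
    · simp [laplacian_eq_zero_of_notMem_tsupport hzs]
  have i₁ : Integrable fun z => (Real.log ‖z - z₀‖ : ℂ) * Δ ψ z := by
    have hl : LocallyIntegrable fun z : ℂ => Real.log ‖z‖ := locallyIntegrable_log_norm
    have hci : HasCompactSupport fun z => Δ ψ (z + z₀) :=
      hΔc.comp_homeomorph (Homeomorph.addRight z₀)
    have := hl.integrable_smul_right_of_hasCompactSupport
      (hΔ.comp (continuous_id.add continuous_const)) hci
    have := this.comp_sub_right z₀
    simpa using this
  have i₂ : Integrable fun z => (Real.log ‖h z‖ : ℂ) * Δ ψ z := by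
    refine Continuous.integrable_of_hasCompactSupport ?_ hΔc.mul_left
    refine continuous_iff_continuousAt.2 fun z => ?_
    by_cases hz : z ∈ W
    · exact (hsm'.continuousOn.continuousAt (hWo.mem_nhds hz)).mul hΔ.continuousAt
    · have h₁ : Δ ψ =ᶠ[𝓝 z] fun _ => 0 := by
        have : (tsupport ψ)ᶜ ∈ 𝓝 z :=
          (isClosed_tsupport ψ).isOpen_compl.mem_nhds fun h => hz (hsW h)
        filter_upwards [this] with w hw using laplacian_eq_zero_of_notMem_tsupport hw
      refine (continuousAt_const (y := (0 : ℂ))).congr ?_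
      filter_upwards [h₁] with w hw
      simp [hw]
  refine ⟨((i₁.const_mul _).add i₂).congr e₁.symm, ?_⟩
  rw [integral_congr_ae e₁, integral_add (i₁.const_mul _) i₂, integral_const_mul]
  have e₂ : ∫ z, (Real.log ‖h z‖ : ℂ) * Δ ψ z = 0 := by
    rw [integral_mul_laplacian hWo hsm' hψ hc hsW]
    refine integral_eq_zero_of_ae (Eventually.of_forall fun z => ?_)
    by_cases hz : z ∈ tsupport ψ
    · have hz' := hW z (hsW hz)
      have h₁ := (hz'.1.harmonicAt_log_norm hz'.2.1).comp_CLM Complex.ofRealCLM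
      have h₂ : Δ (fun z => (Real.log ‖h z‖ : ℂ)) z = 0 := h₁.2.eq_of_nhds
      simp [h₂]
    · simp [image_eq_zero_of_notMem_tsupport hz]
  have e₃ : ∫ z, (Real.log ‖z - z₀‖ : ℂ) * Δ ψ z = 2 * Real.pi * ψ z₀ := by
    let T : ℂ → ℂ := fun z => z + z₀
    have hT : ContDiff ℝ ∞ T := contDiff_id.add contDiff_const
    have h₁ := integral_log_norm_mul_laplacian (hψ.comp hT)
      (hc.comp_homeomorph (Homeomorph.addRight z₀))
    have h₂ (z : ℂ) : Δ (ψ ∘ T : ℂ → ℂ) z = Δ ψ (z + z₀) := by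
      have hd : deriv T z = 1 := by simp [T]
      rw [laplacian_comp_analyticAt (T := T)
        (hψ.of_le (by decide)).contDiffAt (analyticAt_id.add analyticAt_const), hd]
      simp [T]
    simp only [h₂] at h₁
    rw [← integral_add_right_eq_self _ z₀]
    simpa [T] using h₁
  rw [e₂, e₃]
  ring

/-! ### Topology and smooth structure of the curve -/

namespace HyperellipticCurve

variable {g : ℕ} {E : HyperellipticEquation g}

theorem ofInfinity_zero (w : ℂ) (hw : w ^ 2 = E.h.eval 0) :
    ofInfinity (E := E) ⟨(0, w), hw⟩ = infinity w hw := by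
  simp [ofInfinity]

theorem isCompact_affineCurve (p : Polynomial ℂ) :
    IsCompact {q : AffineCurve p | ‖q.1.1‖ ≤ 1} := by
  have hcl : IsClosed {q : ℂ × ℂ | q.2 ^ 2 = p.eval q.1} :=
    isClosed_eq (by fun_prop) (by fun_prop)
  have hemb : IsClosedEmbedding (Subtype.val : AffineCurve p → ℂ × ℂ) :=
    hcl.isClosedEmbedding_subtypeVal
  obtain ⟨C, hC⟩ := (isCompact_closedBall (0 : ℂ) 1).exists_bound_of_continuousOn
    p.continuous.continuousOn
  have hK : IsCompact (Metric.closedBall (0 : ℂ) 1 ×ˢ Metric.closedBall (0 : ℂ) (C + 1)) :=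
    (isCompact_closedBall _ _).prod (isCompact_closedBall _ _)
  refine (hemb.isCompact_preimage hK).of_isClosed_subset
    (isClosed_le (by fun_prop) (by fun_prop)) fun q hq => ?_
  have hq' : ‖q.1.1‖ ≤ 1 := hq
  have h₁ := hC q.1.1 (by simpa using hq')
  rw [← q.2, norm_pow] at h₁
  refine ⟨by simpa using hq', ?_⟩
  rw [mem_closedBall_zero_iff]
  nlinarith [norm_nonneg q.1.2]

instance : CompactSpace (HyperellipticCurve E) where
  isCompact_univ := by
    have h : (univ : Set (HyperellipticCurve E)) =
        ofAffine '' {q | ‖q.1.1‖ ≤ 1} ∪ ofInfinity '' {r | ‖r.1.1‖ ≤ 1} := by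
      refine (eq_univ_of_forall fun P => ?_).symm
      cases P with
      | affine x y hy =>
        rcases le_total ‖x‖ 1 with h | h
        · exact Or.inl ⟨⟨(x, y), hy⟩, h, rfl⟩
        · have hx : x ≠ 0 := norm_pos_iff.1 (one_pos.trans_le h)
          refine Or.inr ⟨⟨(x⁻¹, y / x ^ (g + 1)), ?_⟩, ?_, ?_⟩
          · simp only
            rw [div_pow, hy, E.eval_h (inv_ne_zero hx), inv_inv, inv_pow]
            field_simp
            ring
          · change ‖x⁻¹‖ ≤ 1
            rw [norm_inv]
            exact inv_le_one_of_one_le₀ h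
          · exact ((ofAffine_eq_ofInfinity' ⟨(x, y), hy⟩ _).2 ⟨hx, rfl, rfl⟩).symm
      | infinity w hw =>
        exact Or.inr ⟨⟨(0, w), hw⟩, by simp, ofInfinity_zero w hw⟩
    rw [h]
    exact ((isCompact_affineCurve _).image isOpenEmbedding_ofAffine.continuous).union
      ((isCompact_affineCurve _).image isOpenEmbedding_ofInfinity.continuous)

theorem separated_affine_infinity (x y : ℂ) (hy : y ^ 2 = E.f.eval x) (w : ℂ)
    (hw : w ^ 2 = E.h.eval 0) : ∃ u v : Set (HyperellipticCurve E), IsOpen u ∧ IsOpen v ∧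
      affine x y hy ∈ u ∧ infinity w hw ∈ v ∧ Disjoint u v := by
  have hpos : 0 < ‖x‖ + 1 := by positivity
  refine ⟨ofAffine '' {q | ‖q.1.1‖ < ‖x‖ + 1}, ofInfinity '' {r | ‖r.1.1‖ * (‖x‖ + 1) < 1},
    isOpenEmbedding_ofAffine.isOpenMap _ (isOpen_lt (by fun_prop) (by fun_prop)),
    isOpenEmbedding_ofInfinity.isOpenMap _ (isOpen_lt (by fun_prop) (by fun_prop)),
    ⟨⟨(x, y), hy⟩, by simp, rfl⟩, ⟨⟨(0, w), hw⟩, by simp, ofInfinity_zero w hw⟩, ?_⟩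
  rw [Set.disjoint_left]
  rintro _ ⟨q, hq, rfl⟩ ⟨r, hr, hqr⟩
  obtain ⟨h₁, h₂, -⟩ := (ofAffine_eq_ofInfinity q r).1 hqr.symm
  have hq' : ‖q.1.1‖ < ‖x‖ + 1 := hq
  have hr' : ‖r.1.1‖ * (‖x‖ + 1) < 1 := hr
  rw [h₂, norm_inv] at hq'
  have hrp : 0 < ‖r.1.1‖ := norm_pos_iff.2 h₁
  have h₃ := mul_lt_mul_of_pos_left hq' hrp
  rw [mul_inv_cancel₀ hrp.ne'] at h₃
  linarith

theorem separated_of_isOpenEmbedding {α : Type*} [TopologicalSpace α] [T2Space α]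
    {j : α → HyperellipticCurve E} (hj : IsOpenEmbedding j) {a b : α} (hab : a ≠ b) :
    ∃ u v : Set (HyperellipticCurve E), IsOpen u ∧ IsOpen v ∧ j a ∈ u ∧ j b ∈ v ∧
      Disjoint u v := by
  obtain ⟨u, v, hu, hv, ha, hb, huv⟩ := t2_separation hab
  exact ⟨j '' u, j '' v, hj.isOpenMap _ hu, hj.isOpenMap _ hv, mem_image_of_mem _ ha,
    mem_image_of_mem _ hb, (disjoint_image_iff hj.injective).2 huv⟩

instance : T2Space (HyperellipticCurve E) where
  t2 P Q hPQ := by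
    cases P with
    | affine x y hy =>
      cases Q with
      | affine x' y' hy' =>
        exact separated_of_isOpenEmbedding isOpenEmbedding_ofAffine (a := ⟨(x, y), hy⟩)
          (b := ⟨(x', y'), hy'⟩) fun h => hPQ (congrArg ofAffine h)
      | infinity w hw => exact separated_affine_infinity x y hy w hw
    | infinity w hw =>
      cases Q with
      | affine x y hy =>
        obtain ⟨u, v, hu, hv, h₁, h₂, h⟩ := separated_affine_infinity x y hy w hw
        exact ⟨v, u, hv, hu, h₂, h₁, h.symm⟩
      | infinity w' hw' =>
        have := separated_of_isOpenEmbedding isOpenEmbedding_ofInfinity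
          (a := (⟨(0, w), hw⟩ : AffineCurve E.h)) (b := ⟨(0, w'), hw'⟩) fun h => hPQ (by
            rw [← ofInfinity_zero w hw, h, ofInfinity_zero])
        rwa [ofInfinity_zero, ofInfinity_zero] at this

instance : IsManifold 𝓘(ℝ, ℂ) ∞ (HyperellipticCurve E) := by
  apply isManifold_of_contDiffOn
  rintro _ _ ⟨P, rfl⟩ ⟨Q, rfl⟩
  have := ((transition_differentiableOn P Q).contDiffOn (n := ∞)
    ((chart P).symm.trans (chart Q)).open_source).restrict_scalars ℝ
  simpa using this

/-! ### Transition maps -/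

/-- The change of coordinates from `chart P` to `chart Q`. -/
noncomputable def transition (P Q : HyperellipticCurve E) : ℂ → ℂ := chart Q ∘ (chart P).symm

theorem analyticAt_transition {P Q : HyperellipticCurve E} {ζ : ℂ} (hζ : ζ ∈ (chart P).target)
    (hQ : (chart P).symm ζ ∈ (chart Q).source) : AnalyticAt ℂ (transition P Q) ζ :=
  (transition_differentiableOn P Q).analyticAt
    (((chart P).symm.trans (chart Q)).open_source.mem_nhds ⟨hζ, hQ⟩)

theorem transition_eventually {P Q : HyperellipticCurve E} {ζ : ℂ} (hζ : ζ ∈ (chart P).target)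
    (hQ : (chart P).symm ζ ∈ (chart Q).source) :
    ∀ᶠ z in 𝓝 ζ, z ∈ (chart P).target ∧ (chart P).symm z ∈ (chart Q).source :=
  ((chart P).symm.trans (chart Q)).open_source.mem_nhds ⟨hζ, hQ⟩

theorem symm_transition {P Q : HyperellipticCurve E} {ζ : ℂ}
    (hQ : (chart P).symm ζ ∈ (chart Q).source) :
    (chart Q).symm (transition P Q ζ) = (chart P).symm ζ :=
  (chart Q).left_inv hQ

theorem deriv_transition_ne_zero {P Q : HyperellipticCurve E} {ζ : ℂ}
    (hζ : ζ ∈ (chart P).target) (hQ : (chart P).symm ζ ∈ (chart Q).source) :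
    deriv (transition P Q) ζ ≠ 0 := by
  have h₁ := (analyticAt_transition hζ hQ).differentiableAt.hasDerivAt
  have h₂ : DifferentiableAt ℂ (transition Q P) (transition P Q ζ) :=
    (analyticAt_transition ((chart Q).map_source hQ) (by
      rw [show (chart Q).symm (chart Q ((chart P).symm ζ)) = _ from symm_transition hQ]
      exact (chart P).map_target hζ)).differentiableAt
  have h₃ := h₂.hasDerivAt.comp ζ h₁
  have h₄ : transition Q P ∘ transition P Q =ᶠ[𝓝 ζ] id := by
    filter_upwards [transition_eventually hζ hQ] with z hz
    change chart P ((chart Q).symm (transition P Q z)) = z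
    rw [symm_transition hz.2, (chart P).right_inv hz.1]
  have h₅ := h₃.unique ((hasDerivAt_id ζ).congr_of_eventuallyEq h₄)
  intro h
  simp [h] at h₅

theorem mdifferentiableAt_chart_symm {P : HyperellipticCurve E} {ζ : ℂ}
    (hζ : ζ ∈ (chart P).target) : MDifferentiableAt 𝓘(ℂ) 𝓘(ℂ) (chart P).symm ζ := by
  have : IsManifold 𝓘(ℂ) 1 (HyperellipticCurve E) := IsManifold.of_le (n := ω) le_top
  exact mdifferentiableAt_atlas_symm (mem_range_self P) hζ

/-- The value of `ωᵢ` on the velocity `γ'(ζ)` of a curve `γ`, as a complex number. -/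
noncomputable def formAlong (i : ℕ) (γ : ℂ → HyperellipticCurve E) (ζ : ℂ) : ℂ :=
  holomorphicForm i (γ ζ) (mfderiv 𝓘(ℂ) 𝓘(ℂ) γ ζ (1 : ℂ))

theorem formAlong_congr (i : ℕ) {γ γ' : ℂ → HyperellipticCurve E} {ζ : ℂ} (h : γ =ᶠ[𝓝 ζ] γ') :
    formAlong i γ ζ = formAlong i γ' ζ := by
  let K : HyperellipticCurve E → ℂ →L[ℂ] ℂ := fun P => holomorphicForm i P
  let A : ℂ →L[ℂ] ℂ := mfderiv 𝓘(ℂ) 𝓘(ℂ) γ ζ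
  let B : ℂ →L[ℂ] ℂ := mfderiv 𝓘(ℂ) 𝓘(ℂ) γ' ζ
  have hAB : A = B := h.mfderiv_eq
  change K (γ ζ) (A 1) = K (γ' ζ) (B 1)
  rw [hAB, h.eq_of_nhds]

theorem formAlong_comp (i : ℕ) {γ : ℂ → HyperellipticCurve E} {T : ℂ → ℂ} {ζ : ℂ}
    (hγ : MDifferentiableAt 𝓘(ℂ) 𝓘(ℂ) γ (T ζ)) (hT : DifferentiableAt ℂ T ζ) :
    formAlong i (γ ∘ T) ζ = deriv T ζ * formAlong i γ (T ζ) := by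
  let K : ℂ →L[ℂ] ℂ := holomorphicForm i (γ (T ζ))
  let A : ℂ →L[ℂ] ℂ := mfderiv 𝓘(ℂ) 𝓘(ℂ) (γ ∘ T) ζ
  let B : ℂ →L[ℂ] ℂ := mfderiv 𝓘(ℂ) 𝓘(ℂ) γ (T ζ)
  let C : ℂ →L[ℂ] ℂ := mfderiv 𝓘(ℂ) 𝓘(ℂ) T ζ
  have h : A = B.comp C := mfderiv_comp ζ hγ hT.mdifferentiableAt
  have hC : C 1 = deriv T ζ • (1 : ℂ) := by
    have hC' : C = fderiv ℂ T ζ := mfderiv_eq_fderiv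
    rw [hC', fderiv_apply_one_eq_deriv, smul_eq_mul, mul_one]
  change K (A 1) = deriv T ζ * K (B 1)
  rw [h, ContinuousLinearMap.comp_apply, hC, map_smul, map_smul, smul_eq_mul]

theorem conformalFactor_eq_sum (e : OpenPartialHomeomorph (HyperellipticCurve E) ℂ) (ζ : ℂ) :
    conformalFactor e ζ = ∑ i ∈ Finset.range g, ‖formAlong i e.symm ζ‖ ^ 2 := rfl

/-- The conformal factors in two charts differ by `|T'| ^ 2`, for the change of coordinates `T`. -/
theorem conformalFactor_transition {P Q : HyperellipticCurve E} {ζ : ℂ}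
    (hζ : ζ ∈ (chart P).target) (hQ : (chart P).symm ζ ∈ (chart Q).source) :
    conformalFactor (chart P) ζ =
      ‖deriv (transition P Q) ζ‖ ^ 2 * conformalFactor (chart Q) (transition P Q ζ) := by
  have h₁ : (chart P).symm =ᶠ[𝓝 ζ] (chart Q).symm ∘ transition P Q := by
    filter_upwards [transition_eventually hζ hQ] with z hz using (symm_transition hz.2).symm
  rw [conformalFactor_eq_sum, conformalFactor_eq_sum, Finset.mul_sum]
  refine Finset.sum_congr rfl fun i _ => ?_
  rw [formAlong_congr i h₁,
    formAlong_comp i (mdifferentiableAt_chart_symm ((chart Q).map_source hQ))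
    (analyticAt_transition hζ hQ).differentiableAt, norm_mul, mul_pow]

/-! ### The generic points of the curve -/

/-- The points of `C₀` with `y ≠ 0`: those where `x` is a local coordinate. -/
def generic (E : HyperellipticEquation g) : Set (HyperellipticCurve E) :=
  {P | ∃ x y hy, P = affine x y hy ∧ y ≠ 0}

theorem finite_compl_generic : (generic E)ᶜ.Finite := by
  have hf : {x : ℂ | E.f.eval x = 0}.Finite := by
    refine (E.f.roots.toFinset.finite_toSet).subset fun x hx => ?_
    simpa [E.separable.ne_zero] using hx
  have h₁ : (ofAffine (E := E) '' {q | q.1.2 = 0}).Finite := by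
    refine Finite.image _ ?_
    refine Finite.of_finite_image (f := fun q => q.1.1) (hf.subset ?_) ?_
    · rintro _ ⟨q, hq, rfl⟩
      have hq' : q.1.2 = 0 := hq
      have := q.2
      rw [hq'] at this
      simpa using this.symm
    · intro q hq r hr h
      exact Subtype.ext (Prod.ext h (hq.trans (Eq.symm hr)))
  have h₂ : (ofInfinity (E := E) '' {q | q.1.1 = 0}).Finite := by
    refine Finite.image _ ?_
    have hw : {w : ℂ | w ^ 2 = E.h.eval 0}.Finite := by
      refine ((Polynomial.nthRoots 2 (E.h.eval 0)).toFinset.finite_toSet).subset fun w hw => ?_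
      simpa [Polynomial.mem_nthRoots] using hw
    refine Finite.of_finite_image (f := fun q => q.1.2) (hw.subset ?_) ?_
    · rintro _ ⟨q, hq, rfl⟩
      have hq' : q.1.1 = 0 := hq
      have := q.2
      rwa [hq'] at this
    · intro q hq r hr h
      exact Subtype.ext (Prod.ext (hq.trans (Eq.symm hr)) h)
  refine (h₁.union h₂).subset fun P hP => ?_
  cases P with
  | affine x y hy =>
    left
    refine ⟨⟨(x, y), hy⟩, ?_, rfl⟩
    by_contra h
    exact hP ⟨x, y, hy, rfl, h⟩
  | infinity w hw => exact Or.inr ⟨⟨(0, w), hw⟩, rfl, ofInfinity_zero w hw⟩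

theorem xCoord_eventuallyEq_chart {Q : HyperellipticCurve E} (hQ : Q ∈ generic E) :
    xCoord =ᶠ[𝓝 Q] chart Q := by
  obtain ⟨x, y, hy, rfl, h⟩ := hQ
  filter_upwards [(chart (affine x y hy)).open_source.mem_nhds (mem_chart_source' _)]
  rintro _ ⟨q, hq, rfl⟩
  change q.1.1 = ((AffineCurve.chart E.f ⟨(x, y), hy⟩ (E.f_nonsingular x y hy)).lift_openEmbedding
    isOpenEmbedding_ofAffine) (ofAffine q)
  rw [OpenPartialHomeomorph.lift_openEmbedding_apply]
  simp only [AffineCurve.chart, h, dif_neg, not_false_eq_true]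
  rfl

theorem holomorphicForm_of_mem_generic (i : ℕ) {Q : HyperellipticCurve E} (hQ : Q ∈ generic E) :
    holomorphicForm i Q = (xCoord Q ^ i / yCoord Q) • mfderiv 𝓘(ℂ) 𝓘(ℂ) (xCoord (E := E)) Q := by
  obtain ⟨x, y, hy, rfl, h⟩ := hQ
  exact if_neg h

theorem formAlong_chart_symm (i : ℕ) {P : HyperellipticCurve E} {ζ : ℂ}
    (hζ : ζ ∈ (chart P).target) (hg : (chart P).symm ζ ∈ generic E) :
    formAlong i (chart P).symm ζ = xCoord ((chart P).symm ζ) ^ i / yCoord ((chart P).symm ζ) *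
      deriv (xCoord ∘ (chart P).symm) ζ := by
  set Q := (chart P).symm ζ with hQ
  have hx : MDifferentiableAt 𝓘(ℂ) 𝓘(ℂ) (xCoord (E := E)) Q := by
    have : IsManifold 𝓘(ℂ) 1 (HyperellipticCurve E) := IsManifold.of_le (n := ω) le_top
    exact (mdifferentiableAt_atlas (mem_range_self Q) (mem_chart_source' Q)).congr_of_eventuallyEq
      (xCoord_eventuallyEq_chart hg)
  let A : ℂ →L[ℂ] ℂ := mfderiv 𝓘(ℂ) 𝓘(ℂ) (xCoord (E := E)) Q
  let B : ℂ →L[ℂ] ℂ := mfderiv 𝓘(ℂ) 𝓘(ℂ) (chart P).symm ζ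
  let C : ℂ →L[ℂ] ℂ := mfderiv 𝓘(ℂ) 𝓘(ℂ) (xCoord ∘ (chart P).symm) ζ
  have h : C = A.comp B := mfderiv_comp ζ hx (mdifferentiableAt_chart_symm hζ)
  have hC : C 1 = deriv (xCoord ∘ (chart P).symm) ζ := by
    have hC' : C = fderiv ℂ (xCoord ∘ (chart P).symm) ζ := mfderiv_eq_fderiv
    rw [hC', fderiv_apply_one_eq_deriv]
  rw [← hC, h]
  change (holomorphicForm i Q : ℂ →L[ℂ] ℂ) (B 1) = _
  rw [holomorphicForm_of_mem_generic i hg]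
  rfl

/-- At the generic points `x ∘ (chart P).symm` is a change of coordinates. -/
theorem deriv_xCoord_ne_zero {P : HyperellipticCurve E} {ζ : ℂ}
    (hζ : ζ ∈ (chart P).target) (hg : (chart P).symm ζ ∈ generic E) :
    deriv (xCoord ∘ (chart P).symm) ζ ≠ 0 := by
  have h : xCoord ∘ (chart P).symm =ᶠ[𝓝 ζ] transition P ((chart P).symm ζ) :=
    ((chart P).symm.continuousAt hζ).eventually (xCoord_eventuallyEq_chart hg)
  rw [h.deriv_eq]
  exact deriv_transition_ne_zero hζ (mem_chart_source' _)

theorem conformalFactor_eq {P : HyperellipticCurve E} {ζ : ℂ}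
    (hζ : ζ ∈ (chart P).target) (hg : (chart P).symm ζ ∈ generic E) :
    conformalFactor (chart P) ζ = ‖deriv (xCoord ∘ (chart P).symm) ζ‖ ^ 2 *
      ∑ i ∈ Finset.range g,
        ‖xCoord ((chart P).symm ζ) ^ i / yCoord ((chart P).symm ζ)‖ ^ 2 := by
  rw [conformalFactor_eq_sum, Finset.mul_sum]
  refine Finset.sum_congr rfl fun i _ => ?_
  rw [formAlong_chart_symm i hζ hg, norm_mul, mul_pow, mul_comm]

theorem conformalFactor_nonneg (e : OpenPartialHomeomorph (HyperellipticCurve E) ℂ) (ζ : ℂ) :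
    0 ≤ conformalFactor e ζ :=
  Finset.sum_nonneg fun _ _ => by positivity

theorem conformalFactor_pos (hg : 1 ≤ g) {P : HyperellipticCurve E} {ζ : ℂ}
    (hζ : ζ ∈ (chart P).target) (hgen : (chart P).symm ζ ∈ generic E) :
    0 < conformalFactor (chart P) ζ := by
  rw [conformalFactor_eq hζ hgen]
  refine mul_pos (by have := deriv_xCoord_ne_zero hζ hgen; positivity) ?_
  refine lt_of_lt_of_le ?_ (Finset.single_le_sum (fun i _ => by positivity)
    (Finset.mem_range.2 hg))
  obtain ⟨x, y, hy, hxy, h⟩ := hgen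
  rw [hxy]
  have : 0 < ‖y‖ := norm_pos_iff.2 h
  simp only [yCoord, pow_zero, norm_div, norm_one]
  positivity

/-- The conformal covariance of the Laplacian, in the form `Δφ · ρ = (∂²/∂s² + ∂²/∂t²) φ`. -/
theorem laplaceBeltrami_mul_conformalFactor (hg : 1 ≤ g) {φ : HyperellipticCurve E → ℂ}
    (hφ : ContMDiff 𝓘(ℝ, ℂ) 𝓘(ℝ, ℂ) ∞ φ) {P : HyperellipticCurve E} {ζ : ℂ}
    (hζ : ζ ∈ (chart P).target) (hgen : (chart P).symm ζ ∈ generic E) :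
    conformalFactor (chart P) ζ * laplaceBeltrami φ ((chart P).symm ζ) =
      Δ (φ ∘ (chart P).symm) ζ := by
  set Q := (chart P).symm ζ with hQ
  have hQs : (chart P).symm ζ ∈ (chart Q).source := mem_chart_source' Q
  have hpos := conformalFactor_pos hg hζ hgen
  have htr := conformalFactor_transition hζ hQs
  have hTζ : transition P Q ζ = chart Q Q := rfl
  have hc : conformalFactor (chart Q) (chart Q Q) ≠ 0 := by
    intro h
    rw [hTζ, h, mul_zero] at htr
    exact hpos.ne' htr
  have hφQ : ContDiffAt ℝ 2 (φ ∘ (chart Q).symm) (transition P Q ζ) := by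
    have h₁ : ContMDiffAt 𝓘(ℝ, ℂ) 𝓘(ℝ, ℂ) ∞ (φ ∘ (chart Q).symm) (transition P Q ζ) := by
      have h₂ := (contMDiffOn_symm_of_mem_maximalAtlas (I := 𝓘(ℝ, ℂ)) (n := ∞)
        (IsManifold.subset_maximalAtlas (mem_range_self Q))).contMDiffAt
        ((chart Q).open_target.mem_nhds ((chart Q).map_source hQs))
      exact hφ.contMDiffAt.comp _ h₂
    exact h₁.contDiffAt.of_le (by decide)
  have h₁ : φ ∘ (chart P).symm =ᶠ[𝓝 ζ] (φ ∘ (chart Q).symm) ∘ transition P Q := by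
    filter_upwards [transition_eventually hζ hQs] with z hz
    change φ ((chart P).symm z) = φ ((chart Q).symm (transition P Q z))
    rw [symm_transition hz.2]
  rw [(InnerProductSpace.laplacian_congr_nhds h₁).eq_of_nhds,
    laplacian_comp_analyticAt hφQ (analyticAt_transition hζ hQs), htr, hTζ]
  change _ * (Δ (φ ∘ (chart Q).symm) (chart Q Q) / (conformalFactor (chart Q) (chart Q Q) : ℂ)) = _
  have hc' : (conformalFactor (chart Q) (chart Q Q) : ℂ) ≠ 0 := by exact_mod_cast hc
  rw [Complex.real_smul]
  push_cast
  field_simp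

end HyperellipticCurve

namespace HyperellipticCurve

variable {g : ℕ} {E : HyperellipticEquation g}

/-! ### The area measure in charts -/

/-- The area measure `ρ(ζ) dλ(ζ)` on the target of `chart P`. -/
noncomputable def planeArea (P : HyperellipticCurve E) : Measure ℂ :=
  ((volume : Measure ℂ).restrict (chart P).target).withDensity
    fun ζ => ENNReal.ofReal (conformalFactor (chart P) ζ)

theorem area_eq_iSup :
    (area : Measure (HyperellipticCurve E)) = ⨆ P, (planeArea P).map (chart P).symm := by
  change ⨆ e ∈ range chart, _ = _
  rw [iSup_range]
  rfl

theorem aemeasurable_chart_symm (P : HyperellipticCurve E) :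
    AEMeasurable (chart P).symm (planeArea P) :=
  ((chart P).continuousOn_symm.aemeasurable (chart P).open_target.measurableSet).mono_ac
    (withDensity_absolutelyContinuous _ _)

theorem measurableSet_target_inter (P : HyperellipticCurve E) {A : Set (HyperellipticCurve E)}
    (hA : MeasurableSet A) : MeasurableSet ((chart P).target ∩ (chart P).symm ⁻¹' A) := by
  have h : (chart P).target ∩ (chart P).symm ⁻¹' A =
      Subtype.val '' ((chart P).target.domRestrict (chart P).symm ⁻¹' A) := by
    ext ζ
    simp [and_comm]
  rw [h]
  exact (chart P).open_target.measurableSet.subtype_image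
    ((continuousOn_iff_continuous_domRestrict.1 (chart P).continuousOn_symm).measurable hA)

theorem map_planeArea_apply (P : HyperellipticCurve E) {A : Set (HyperellipticCurve E)}
    (hA : MeasurableSet A) : (planeArea P).map (chart P).symm A =
      ∫⁻ ζ in (chart P).target ∩ (chart P).symm ⁻¹' A,
        ENNReal.ofReal (conformalFactor (chart P) ζ) := by
  rw [Measure.map_apply_of_aemeasurable (aemeasurable_chart_symm P) hA, planeArea,
    withDensity_apply', Measure.restrict_restrict' (chart P).open_target.measurableSet, inter_comm]

theorem abs_det_restrictScalars_toSpanSingleton (a : ℂ) :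
    |((ContinuousLinearMap.toSpanSingleton ℂ a).restrictScalars ℝ).det| = ‖a‖ ^ 2 := by
  simp [ContinuousLinearMap.det, LinearMap.det_restrictScalars, Algebra.norm_complex_eq,
    Complex.normSq_eq_norm_sq]

/-- The local area measures agree on the overlaps of charts. -/
theorem map_planeArea_congr (P Q : HyperellipticCurve E) {A : Set (HyperellipticCurve E)}
    (hA : MeasurableSet A) (hP : A ⊆ (chart P).source) (hQ : A ⊆ (chart Q).source) :
    (planeArea P).map (chart P).symm A = (planeArea Q).map (chart Q).symm A := by
  rw [map_planeArea_apply P hA, map_planeArea_apply Q hA]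
  have himg : transition P Q '' ((chart P).target ∩ (chart P).symm ⁻¹' A) =
      (chart Q).target ∩ (chart Q).symm ⁻¹' A := by
    ext ξ
    constructor
    · rintro ⟨ζ, ⟨hζ, hζA⟩, rfl⟩
      have hs := hQ hζA
      refine ⟨(chart Q).map_source hs, ?_⟩
      rw [mem_preimage, symm_transition hs]
      exact hζA
    · rintro ⟨hξ, hξA⟩
      have hs := hP hξA
      refine ⟨transition Q P ξ, ⟨(chart P).map_source hs, ?_⟩, ?_⟩
      · rw [mem_preimage, symm_transition hs]
        exact hξA
      · change chart Q ((chart P).symm (transition Q P ξ)) = ξ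
        rw [symm_transition hs, (chart Q).right_inv hξ]
  rw [← himg, lintegral_image_eq_lintegral_abs_det_fderiv_mul volume
    (measurableSet_target_inter P hA)
    (f' := fun ζ => (ContinuousLinearMap.toSpanSingleton ℂ
      (deriv (transition P Q) ζ)).restrictScalars ℝ)
    (fun ζ hζ => ((analyticAt_transition hζ.1
      (hQ hζ.2)).differentiableAt.hasDerivAt.hasFDerivAt.restrictScalars ℝ).hasFDerivWithinAt)]
  · refine setLIntegral_congr_fun (measurableSet_target_inter P hA) fun ζ hζ => ?_
    rw [abs_det_restrictScalars_toSpanSingleton, ← ENNReal.ofReal_mul (by positivity)]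
    rw [conformalFactor_transition hζ.1 (hQ hζ.2)]
  · intro ζ hζ ζ' hζ' h
    have h₁ := congrArg (chart Q).symm h
    rw [symm_transition (hQ hζ.2), symm_transition (hQ hζ'.2)] at h₁
    exact (chart P).symm.injOn hζ.1 hζ'.1 h₁

theorem area_apply_of_subset_source (P : HyperellipticCurve E) {A : Set (HyperellipticCurve E)}
    (hA : MeasurableSet A) (hP : A ⊆ (chart P).source) :
    area A = (planeArea P).map (chart P).symm A := by
  refine le_antisymm ?_ (area_eq_iSup (E := E) ▸ le_iSup (fun P : HyperellipticCurve E =>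
    (planeArea P).map (chart P).symm) P A)
  have hs : MeasurableSet (chart P).source := (chart P).open_source.measurableSet
  -- a measure that dominates all the local area measures and is infinite off the chart at `P`
  set N : Measure (HyperellipticCurve E) := (planeArea P).map (chart P).symm +
    ((⊤ : ENNReal) • Measure.count).restrict (chart P).sourceᶜ with hN
  have hle : (area : Measure (HyperellipticCurve E)) ≤ N := by
    rw [area_eq_iSup]
    refine iSup_le fun Q => Measure.le_iff.2 fun B hB => ?_
    rcases eq_empty_or_nonempty (B \ (chart P).source) with h | h
    · have hBP : B ⊆ (chart P).source := sdiff_eq_empty.1 h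
      have hsQ : MeasurableSet (chart Q).source := (chart Q).open_source.measurableSet
      have h₁ : (planeArea Q).map (chart Q).symm B =
          (planeArea Q).map (chart Q).symm (B ∩ (chart Q).source) := by
        rw [map_planeArea_apply Q hB, map_planeArea_apply Q (hB.inter hsQ)]
        congr 2
        ext ζ
        constructor
        · rintro ⟨h₁, h₂⟩
          exact ⟨h₁, h₂, (chart Q).map_target h₁⟩
        · rintro ⟨h₁, h₂⟩
          exact ⟨h₁, h₂.1⟩
      rw [h₁, map_planeArea_congr Q P (hB.inter hsQ) inter_subset_right
        (inter_subset_left.trans hBP)]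
      exact (measure_mono inter_subset_left).trans (Measure.le_add_right le_rfl B)
    · have h₁ : N B = ⊤ := by
        rw [hN, Measure.add_apply, Measure.restrict_apply hB, Measure.smul_apply,
          Measure.count_apply (hB.inter hs.compl)]
        have h₂ : (((B ∩ (chart P).sourceᶜ).encard : ℕ∞) : ENNReal) ≠ 0 := by
          simpa [← sdiff_eq] using h.ne_empty
        rw [smul_eq_mul, ENNReal.top_mul h₂, add_top]
      rw [h₁]
      exact le_top
  refine (hle A).trans_eq ?_
  rw [hN, Measure.add_apply, Measure.restrict_apply hA,
    (disjoint_compl_right_iff_subset.2 hP).inter_eq, measure_empty, add_zero]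

theorem ae_target_symm_notMem (P : HyperellipticCurve E) {B : Set (HyperellipticCurve E)}
    (hB : B.Finite) : ∀ᵐ ζ ∂(volume : Measure ℂ).restrict (chart P).target,
      (chart P).symm ζ ∉ B := by
  rw [ae_restrict_iff' (chart P).open_target.measurableSet]
  have hfin : ((chart P) '' B).Finite := hB.image _
  filter_upwards [hfin.countable.ae_notMem volume] with ζ hζ hζt h
  exact hζ ⟨_, h, (chart P).right_inv hζt⟩

theorem area_singleton (P : HyperellipticCurve E) : area {P} = 0 := by
  rw [area_apply_of_subset_source P (measurableSet_singleton P)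
    (singleton_subset_iff.2 (mem_chart_source' P)),
    map_planeArea_apply P (measurableSet_singleton P)]
  refine setLIntegral_measure_zero _ _ (measure_mono_null (t := {chart P P}) ?_ (by simp))
  rintro ζ ⟨h₁, h₂⟩
  have h₂' : (chart P).symm ζ = P := h₂
  rw [mem_singleton_iff, ← (chart P).right_inv h₁, h₂']

instance : NullSingletonClass (area : Measure (HyperellipticCurve E)) := ⟨area_singleton⟩

theorem measurable_of_continuous_comp_ofAffine {α : Type*} [TopologicalSpace α]
    [MeasurableSpace α] [BorelSpace α] {f : HyperellipticCurve E → α}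
    (hf : Continuous (f ∘ ofAffine)) : Measurable f := by
  have hr : MeasurableSet (range (ofAffine (E := E))) :=
    isOpenEmbedding_ofAffine.isOpen_range.measurableSet
  refine measurable_of_restrict_of_restrict_compl hr ?_ ?_
  · refine Continuous.measurable ?_
    have h : f ∘ ofAffine = (range ofAffine).domRestrict f ∘
        isOpenEmbedding_ofAffine.toIsEmbedding.toHomeomorph := rfl
    rw [h] at hf
    exact (Homeomorph.comp_continuous_iff' _).1 hf
  · have hfin : ((range (ofAffine (E := E)))ᶜ).Finite := by
      refine finite_compl_generic.subset (compl_subset_compl.2 ?_)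
      rintro _ ⟨x, y, hy, rfl, -⟩
      exact ⟨⟨(x, y), hy⟩, rfl⟩
    have := hfin.to_subtype
    exact measurable_of_finite _

theorem measurable_xCoord : Measurable (xCoord (E := E)) :=
  measurable_of_continuous_comp_ofAffine (by
    change Continuous fun q : AffineCurve E.f => q.1.1
    fun_prop)

theorem measurable_yCoord : Measurable (yCoord (E := E)) :=
  measurable_of_continuous_comp_ofAffine (by
    change Continuous fun q : AffineCurve E.f => q.1.2
    fun_prop)

/-- The formula for `ρ` at the generic points gives its measurability up to a null set. -/
theorem aemeasurable_conformalFactor (P : HyperellipticCurve E) :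
    AEMeasurable (conformalFactor (chart P)) (volume.restrict (chart P).target) := by
  have hs : AEMeasurable (chart P).symm (volume.restrict (chart P).target) :=
    (chart P).continuousOn_symm.aemeasurable (chart P).open_target.measurableSet
  have hκ : Measurable fun Q : HyperellipticCurve E =>
      ∑ i ∈ Finset.range g, ‖xCoord Q ^ i / yCoord Q‖ ^ 2 :=
    Finset.measurable_sum _ fun i _ =>
      ((measurable_xCoord.pow_const i).div measurable_yCoord).norm.pow_const 2
  refine AEMeasurable.congr (f := fun ζ => ‖deriv (xCoord ∘ (chart P).symm) ζ‖ ^ 2 *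
      ∑ i ∈ Finset.range g, ‖xCoord ((chart P).symm ζ) ^ i / yCoord ((chart P).symm ζ)‖ ^ 2)
    (((measurable_deriv _).norm.pow_const 2).aemeasurable.mul (hκ.comp_aemeasurable hs)) ?_
  filter_upwards [ae_target_symm_notMem P finite_compl_generic,
    ae_restrict_mem (chart P).open_target.measurableSet] with ζ h₁ h₂
  exact (conformalFactor_eq h₂ (not_not.1 h₁)).symm

/-- In the chart at `P`, the area measure of `X` is `ρ(ζ) dλ(ζ)`. -/
theorem map_comap_area (P : HyperellipticCurve E) :
    ((area : Measure (HyperellipticCurve E)).comap (Subtype.val : (chart P).source → _)).map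
      ((chart P).source.domRestrict (chart P)) = planeArea P := by
  have hs : MeasurableSet (chart P).source := (chart P).open_source.measurableSet
  have hemb := (chart P).isOpenEmbedding_restrict.measurableEmbedding
  ext A hA
  have hA' : MeasurableSet (Subtype.val '' ((chart P).source.domRestrict (chart P) ⁻¹' A)) :=
    hs.subtype_image (hemb.measurable hA)
  rw [hemb.map_apply, (MeasurableEmbedding.subtype_coe hs).comap_apply,
    area_apply_of_subset_source P hA' (by rintro _ ⟨q, -, rfl⟩; exact q.2),
    map_planeArea_apply P hA', planeArea, withDensity_apply _ hA, Measure.restrict_restrict hA]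
  congr 2
  ext ζ
  constructor
  · rintro ⟨h₁, ⟨q, h₂, h₃⟩⟩
    refine ⟨?_, h₁⟩
    have h₄ : chart P q ∈ A := h₂
    rwa [h₃, (chart P).right_inv h₁] at h₄
  · rintro ⟨h₁, h₂⟩
    refine ⟨h₂, ⟨⟨_, (chart P).map_target h₂⟩, ?_, rfl⟩⟩
    change chart P ((chart P).symm ζ) ∈ A
    rwa [(chart P).right_inv h₂]

theorem integrableOn_source_iff (P : HyperellipticCurve E) (F : HyperellipticCurve E → ℂ) :
    IntegrableOn F (chart P).source area ↔
      IntegrableOn (fun ζ => (conformalFactor (chart P) ζ : ℂ) * F ((chart P).symm ζ))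
        (chart P).target := by
  have hs : MeasurableSet (chart P).source := (chart P).open_source.measurableSet
  have hemb := (chart P).isOpenEmbedding_restrict.measurableEmbedding
  have h₁ : F ∘ (Subtype.val : (chart P).source → _) =
      (F ∘ (chart P).symm) ∘ (chart P).source.domRestrict (chart P) := by
    ext q
    exact congrArg F ((chart P).left_inv q.2).symm
  rw [integrableOn_iff_comap_subtypeVal hs, h₁, ← hemb.integrable_map_iff, map_comap_area,
    planeArea, integrable_withDensity_iff_integrable_smul₀'
      (aemeasurable_conformalFactor P).ennreal_ofReal (by simp), IntegrableOn]
  simp [ENNReal.toReal_ofReal (conformalFactor_nonneg _ _)]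

theorem setIntegral_source (P : HyperellipticCurve E) (F : HyperellipticCurve E → ℂ) :
    ∫ Q in (chart P).source, F Q ∂area =
      ∫ ζ in (chart P).target, (conformalFactor (chart P) ζ : ℂ) * F ((chart P).symm ζ) := by
  have hs : MeasurableSet (chart P).source := (chart P).open_source.measurableSet
  have hemb := (chart P).isOpenEmbedding_restrict.measurableEmbedding
  have h₁ (q : (chart P).source) : F q =
      (F ∘ (chart P).symm) ((chart P).source.domRestrict (chart P) q) :=
    congrArg F ((chart P).left_inv q.2).symm
  rw [← integral_subtype_comap hs]
  simp only [h₁]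
  rw [← hemb.integral_map, map_comap_area, planeArea,
    integral_withDensity_eq_integral_toReal_smul₀
      (aemeasurable_conformalFactor P).ennreal_ofReal (by simp)]
  simp [ENNReal.toReal_ofReal (conformalFactor_nonneg _ _)]

end HyperellipticCurve

/-! ### Orders of vanishing in charts -/

namespace AffineCurve

variable (p : Polynomial ℂ)

theorem analyticAt_chart_symm (q : AffineCurve p)
    (hq : q.1.2 ≠ 0 ∨ p.derivative.eval q.1.1 ≠ 0) :
    AnalyticAt ℂ (fun ζ => ((chart p q hq).symm ζ).1.1) (chart p q hq q) :=
  (chart_symm_differentiableOn p q hq).1.analyticAt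
    ((chart p q hq).open_target.mem_nhds ((chart p q hq).map_source (mem_chart_source p q hq)))

theorem chart_symm_chart (q : AffineCurve p) (hq : q.1.2 ≠ 0 ∨ p.derivative.eval q.1.1 ≠ 0) :
    (chart p q hq).symm (chart p q hq q) = q :=
  (chart p q hq).left_inv (mem_chart_source p q hq)

open scoped Classical in
/-- The divisor of `x - a` on `y ^ 2 = p x` is `(a, b) + (a, -b)`, where `b ^ 2 = p a`: at a point
with `y ≠ 0` the function `x` is a coordinate, and at a point with `y = 0` it is the coordinate `y`
whose square is `x - a` times a unit. -/
theorem analyticOrderAt_x_sub (q : AffineCurve p)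
    (hq : q.1.2 ≠ 0 ∨ p.derivative.eval q.1.1 ≠ 0) {a b : ℂ} (hab : b ^ 2 = p.eval a) :
    analyticOrderAt (fun ζ => ((chart p q hq).symm ζ).1.1 - a) (chart p q hq q) =
      ((if (a, b) = q.1 then 1 else 0) + (if (a, -b) = q.1 then 1 else 0) : ℕ) := by
  have han := analyticAt_chart_symm p q hq
  have han' : AnalyticAt ℂ (fun ζ => ((chart p q hq).symm ζ).1.1 - a) (chart p q hq q) :=
    han.sub analyticAt_const
  by_cases hx : q.1.1 = a
  · have hb : q.1.2 ^ 2 = b ^ 2 := by rw [q.2, hx, hab]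
    by_cases hy : q.1.2 = 0
    · have hb0 : b = 0 := by simpa [hy] using hb.symm
      have h₁ : (a, b) = q.1 := Prod.ext hx.symm (hb0.trans hy.symm)
      have h₂ : (a, -b) = q.1 := Prod.ext hx.symm (by simp [hb0, hy])
      rw [if_pos h₁, if_pos h₂, han'.analyticOrderAt_eq_natCast]
      have ha : p.derivative.eval a ≠ 0 := hx ▸ hq.resolve_left (not_not.2 hy)
      have hroot : p.IsRoot a := by
        rw [Polynomial.IsRoot, ← hab, hb0]
        simp
      obtain ⟨r, hr⟩ := Polynomial.dvd_iff_isRoot.2 hroot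
      have hr0 : r.eval a ≠ 0 := by
        rw [hr] at ha
        simpa using ha
      have hev : ∀ t, p.eval t = (t - a) * r.eval t := fun t => by
        conv_lhs => rw [hr]
        simp
      have hc : ∀ s, chart p q hq s = s.1.2 := fun s => by
        simp only [chart, hy, dif_pos]
        rfl
      have hζ₀ : chart p q hq q = 0 := by rw [hc, hy]
      have hval : ((chart p q hq).symm (chart p q hq q)).1.1 = a := by
        rw [chart_symm_chart, hx]
      have hran : AnalyticAt ℂ (fun ζ => r.eval ((chart p q hq).symm ζ).1.1) (chart p q hq q) :=
        (r.differentiable.analyticAt _).comp han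
      have hrne : r.eval ((chart p q hq).symm (chart p q hq q)).1.1 ≠ 0 := by rwa [hval]
      -- the coordinate is `y`, and `y ^ 2 = p x = (x - a) * r x`
      refine ⟨fun ζ => (r.eval ((chart p q hq).symm ζ).1.1)⁻¹, hran.inv hrne, inv_ne_zero hrne, ?_⟩
      filter_upwards [(chart p q hq).open_target.mem_nhds
        ((chart p q hq).map_source (mem_chart_source p q hq)),
        hran.continuousAt.eventually_ne hrne] with ζ h₃ h₄
      have h₅ := (chart p q hq).right_inv h₃
      rw [hc] at h₅
      have h₆ := ((chart p q hq).symm ζ).2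
      rw [h₅, hev] at h₆
      rw [hζ₀, sub_zero, smul_eq_mul, show 1 + 1 = 2 from rfl, h₆]
      field_simp
    · have h1 : ((if (a, b) = q.1 then 1 else 0) + (if (a, -b) = q.1 then 1 else 0) : ℕ) = 1 := by
        have hb0 : b ≠ 0 := by
          rintro rfl
          exact hy (by simpa using hb)
        have hne : b ≠ -b := fun h => hb0 (self_eq_neg.1 h)
        rcases sq_eq_sq_iff_eq_or_eq_neg.1 hb with h | h
        · rw [if_pos (Prod.ext hx.symm h.symm), if_neg]
          intro h'
          exact hne (h.symm.trans (congrArg Prod.snd h').symm)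
        · rw [if_neg, if_pos (Prod.ext hx.symm h.symm)]
          intro h'
          exact hne ((congrArg Prod.snd h').trans h)
      rw [h1, han'.analyticOrderAt_eq_natCast]
      have hc : ∀ s, chart p q hq s = s.1.1 := fun s => by
        simp only [chart, hy, dif_neg, not_false_eq_true]
        rfl
      refine ⟨fun _ => 1, analyticAt_const, one_ne_zero, ?_⟩
      filter_upwards [(chart p q hq).open_target.mem_nhds
        ((chart p q hq).map_source (mem_chart_source p q hq))] with ζ h₃
      have h₅ := (chart p q hq).right_inv h₃
      rw [hc] at h₅
      rw [h₅, hc, hx]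
      simp
  · have h₁ : (a, b) ≠ q.1 := fun h => hx (congrArg Prod.fst h).symm
    have h₂ : (a, -b) ≠ q.1 := fun h => hx (congrArg Prod.fst h).symm
    rw [if_neg h₁, if_neg h₂]
    refine han'.analyticOrderAt_eq_zero.2 ?_
    rw [chart_symm_chart]
    exact sub_ne_zero.2 hx

end AffineCurve

namespace HyperellipticCurve

theorem normalizer_pos {g : ℕ} (hg : 1 ≤ g) {t : ℝ} (ht : 0 ≤ t) :
    0 < normalizer g t := by
  refine Real.rpow_pos_of_pos (mul_pos ?_ (by positivity)) _
  refine lt_of_lt_of_le one_pos ?_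
  rw [← pow_zero t]
  exact Finset.single_le_sum (f := fun i => t ^ i) (fun i _ => by positivity)
    (Finset.mem_range.2 hg)

variable {g : ℕ} {E : HyperellipticEquation g}

open scoped Classical in
/-- The multiplicity of `Q` in the divisor `P + ι(P)`. -/
noncomputable def multiplicity (P Q : HyperellipticCurve E) : ℕ :=
  (if P = Q then 1 else 0) + (if involution P = Q then 1 else 0)

theorem chart_affine_symm (x y : ℂ) (hy : y ^ 2 = E.f.eval x) (ζ : ℂ) :
    (chart (affine x y hy)).symm ζ = ofAffine
      ((AffineCurve.chart E.f ⟨(x, y), hy⟩ (E.f_nonsingular x y hy)).symm ζ) := rfl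

theorem chart_infinity_symm (w : ℂ) (hw : w ^ 2 = E.h.eval 0) (ζ : ℂ) :
    (chart (infinity w hw)).symm ζ = ofInfinity
      ((AffineCurve.chart E.h ⟨(0, w), hw⟩ (E.h_nonsingular w hw)).symm ζ) := rfl

theorem chart_affine_self (x y : ℂ) (hy : y ^ 2 = E.f.eval x) :
    chart (affine x y hy) (affine x y hy) =
      AffineCurve.chart E.f ⟨(x, y), hy⟩ (E.f_nonsingular x y hy) ⟨(x, y), hy⟩ := by
  change ((AffineCurve.chart E.f ⟨(x, y), hy⟩ (E.f_nonsingular x y hy)).lift_openEmbedding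
    isOpenEmbedding_ofAffine) (ofAffine ⟨(x, y), hy⟩) = _
  rw [OpenPartialHomeomorph.lift_openEmbedding_apply]

theorem chart_infinity_self (w : ℂ) (hw : w ^ 2 = E.h.eval 0) :
    chart (infinity w hw) (infinity w hw) =
      AffineCurve.chart E.h ⟨(0, w), hw⟩ (E.h_nonsingular w hw) ⟨(0, w), hw⟩ := by
  nth_rewrite 2 [← ofInfinity_zero w hw]
  exact OpenPartialHomeomorph.lift_openEmbedding_apply _ isOpenEmbedding_ofInfinity

/-- Near each point, the functions `F_P` are, up to a common positive factor, the absolute values of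
holomorphic functions with divisors `P + ι(P)`. -/
theorem exists_pointFunction_eq (hg : 1 ≤ g) (Q : HyperellipticCurve E) :
    ∃ M : ℂ → ℝ, (∀ ζ, 0 < M ζ) ∧ ∀ P : HyperellipticCurve E, ∃ G : ℂ → ℂ,
      AnalyticAt ℂ G (chart Q Q) ∧ analyticOrderAt G (chart Q Q) = multiplicity P Q ∧
      ∀ ζ, pointFunction P ((chart Q).symm ζ) = ‖G ζ‖ / M ζ := by
  cases Q with
  | affine x y hy =>
    rw [chart_affine_self]
    simp only [chart_affine_symm]
    set c := AffineCurve.chart E.f ⟨(x, y), hy⟩ (E.f_nonsingular x y hy) with hc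
    refine ⟨fun ζ => normalizer g (‖(c.symm ζ).1.1‖ ^ 2),
      fun ζ => normalizer_pos hg (by positivity), fun P => ?_⟩
    cases P with
    | affine a b hab =>
      refine ⟨fun ζ => (c.symm ζ).1.1 - a,
        (AffineCurve.analyticAt_chart_symm _ _ _).sub analyticAt_const, ?_, fun ζ => rfl⟩
      rw [hc, AffineCurve.analyticOrderAt_x_sub _ _ _ hab]
      simp [multiplicity, involution]
    | infinity v hv =>
      refine ⟨fun _ => 1, analyticAt_const, ?_, fun ζ => by simp [ofAffine, pointFunction]⟩
      rw [analyticAt_const.analyticOrderAt_eq_zero.2 one_ne_zero]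
      simp [multiplicity, involution]
  | infinity w hw =>
    rw [chart_infinity_self]
    simp only [chart_infinity_symm]
    set c := AffineCurve.chart E.h ⟨(0, w), hw⟩ (E.h_nonsingular w hw) with hc
    have han := AffineCurve.analyticAt_chart_symm E.h ⟨(0, w), hw⟩ (E.h_nonsingular w hw)
    refine ⟨fun ζ => normalizer g (‖(c.symm ζ).1.1‖ ^ 2),
      fun ζ => normalizer_pos hg (by positivity), fun P => ?_⟩
    cases P with
    | affine a b hab =>
      have hG : AnalyticAt ℂ (fun ζ => 1 - (c.symm ζ).1.1 * a) (c ⟨(0, w), hw⟩) :=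
        analyticAt_const.sub (han.mul analyticAt_const)
      refine ⟨_, hG, ?_, fun ζ => pointFunction_affine_ofInfinity hg a b hab _⟩
      rw [hG.analyticOrderAt_eq_zero.2]
      · simp [multiplicity, involution]
      · rw [hc, AffineCurve.chart_symm_chart]
        simp
    | infinity v hv =>
      refine ⟨fun ζ => (c.symm ζ).1.1 - 0, han.sub analyticAt_const, ?_, fun ζ => ?_⟩
      · rw [hc, AffineCurve.analyticOrderAt_x_sub _ _ _ hv]
        simp [multiplicity, involution]
      · simp only [pointFunction_infinity_ofInfinity hg, sub_zero]

theorem Divisor.sum_multiplicity (D : Divisor E) (Q : HyperellipticCurve E) :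
    ∑ P ∈ D.support, D P * (multiplicity P Q : ℤ) = (D + D.involution) Q := by
  classical
  have h₁ : ∑ P ∈ D.support, D P * (if P = Q then 1 else 0 : ℤ) = D Q := by
    simp [eq_comm]
  have h₂ : ∑ P ∈ D.support, D P * (if HyperellipticCurve.involution P = Q then 1 else 0 : ℤ) =
      D.involution Q := by
    rw [Divisor.involution, Finsupp.mapDomain, Finsupp.sum, Finsupp.finsetSum_apply]
    refine Finset.sum_congr rfl fun P _ => ?_
    simp [Finsupp.single_apply]
  rw [Finsupp.add_apply, ← h₁, ← h₂, ← Finset.sum_add_distrib]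
  refine Finset.sum_congr rfl fun P _ => ?_
  simp only [multiplicity]
  push_cast
  ring

/-- For a divisor of degree zero the normalizing factors cancel in `F_D`. -/
theorem Divisor.u_eq_sum {D : Divisor E} (hD : D.deg = 0) {Q : HyperellipticCurve E} {M : ℝ}
    (hM : 0 < M) {r : HyperellipticCurve E → ℝ}
    (hr : ∀ P ∈ D.support, pointFunction P Q = r P / M) (hr0 : ∀ P ∈ D.support, r P ≠ 0) :
    D.u Q = ∑ P ∈ D.support, D P * Real.log (r P) := by
  have h₁ : ∀ P ∈ D.support, pointFunction P Q ^ (D P) ≠ 0 := fun P hP => by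
    rw [hr P hP]
    exact zpow_ne_zero _ (div_ne_zero (hr0 P hP) hM.ne')
  rw [Divisor.u, Divisor.F, Finsupp.prod, Real.log_prod h₁]
  have h₂ : ∀ P ∈ D.support, Real.log (pointFunction P Q ^ (D P)) =
      D P * Real.log (r P) - D P * Real.log M := fun P hP => by
    rw [Real.log_zpow, hr P hP, Real.log_div (hr0 P hP) hM.ne', mul_sub]
  have h₃ : (∑ P ∈ D.support, (D P : ℝ)) = 0 := by
    have : ∑ P ∈ D.support, D P = 0 := hD
    exact_mod_cast this
  rw [Finset.sum_congr rfl h₂, Finset.sum_sub_distrib, ← Finset.sum_mul, h₃, zero_mul, sub_zero]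

/-- In the chart at `Q`, the distributional Laplacian of `u_D` is `2π` times the Dirac mass at `Q`
with the multiplicity of `Q` in `D + ι(D)`. -/
theorem eventually_integral_u_mul_laplacian (hg : 1 ≤ g) {D : Divisor E} (hD : D.deg = 0)
    (Q : HyperellipticCurve E) :
    ∀ᶠ V in (𝓝 (chart Q Q)).smallSets, ∀ ψ : ℂ → ℂ, ContDiff ℝ ∞ ψ → HasCompactSupport ψ →
      tsupport ψ ⊆ V → Integrable (fun ζ => (D.u ((chart Q).symm ζ) : ℂ) * Δ ψ ζ) ∧
        ∫ ζ, (D.u ((chart Q).symm ζ) : ℂ) * Δ ψ ζ =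
          2 * Real.pi * ((D + D.involution) Q : ℤ) * ψ (chart Q Q) := by
  obtain ⟨M, hM, hG⟩ := exists_pointFunction_eq hg Q
  choose G hGan hGord hG using hG
  have h₁ : ∀ᶠ V in (𝓝 (chart Q Q)).smallSets, ∀ P ∈ D.support, ∀ ψ : ℂ → ℂ, ContDiff ℝ ∞ ψ →
      HasCompactSupport ψ → tsupport ψ ⊆ V →
      Integrable (fun z => (Real.log ‖G P z‖ : ℂ) * Δ ψ z) ∧
        ∫ z, (Real.log ‖G P z‖ : ℂ) * Δ ψ z = 2 * Real.pi * multiplicity P Q * ψ (chart Q Q) :=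
    (Filter.eventually_all_finset _).2 fun P _ =>
      (hGan P).eventually_integral_log_norm_mul_laplacian (hGord P)
  have h₂ : ∀ᶠ z in 𝓝 (chart Q Q), ∀ P ∈ D.support, z ≠ chart Q Q → G P z ≠ 0 := by
    refine (Filter.eventually_all_finset _).2 fun P _ => ?_
    obtain ⟨k, hk, hk0, hGk⟩ := (hGan P).analyticOrderAt_eq_natCast.1 (hGord P)
    filter_upwards [hGk, hk.continuousAt.eventually_ne hk0] with z h₁ h₂ h₃
    rw [h₁]
    exact smul_ne_zero (pow_ne_zero _ (sub_ne_zero.2 h₃)) h₂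
  filter_upwards [h₁, eventually_smallSets_subset.2 h₂] with V h₁ h₂ ψ hψ hc hs
  have e : (fun ζ => (D.u ((chart Q).symm ζ) : ℂ) * Δ ψ ζ) =ᵐ[volume]
      fun ζ => ∑ P ∈ D.support, (D P : ℂ) * ((Real.log ‖G P ζ‖ : ℂ) * Δ ψ ζ) := by
    have hne : ∀ᵐ z : ℂ, z ≠ chart Q Q := by simp [ae_iff]
    filter_upwards [hne] with ζ hζ
    by_cases hζs : ζ ∈ tsupport ψ
    · have h₃ := h₂ (hs hζs)
      rw [Divisor.u_eq_sum hD (hM ζ) (r := fun P => ‖G P ζ‖) (fun P _ => hG P ζ)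
        (fun P hP => norm_ne_zero_iff.2 (h₃ P hP hζ))]
      push_cast
      rw [Finset.sum_mul]
      exact Finset.sum_congr rfl fun P _ => by ring
    · simp [laplacian_eq_zero_of_notMem_tsupport hζs]
  have hi : ∀ P ∈ D.support,
      Integrable fun ζ => (D P : ℂ) * ((Real.log ‖G P ζ‖ : ℂ) * Δ ψ ζ) :=
    fun P hP => (h₁ P hP ψ hψ hc hs).1.const_mul _
  refine ⟨(integrable_finsetSum _ hi).congr e.symm, ?_⟩
  rw [integral_congr_ae e, integral_finsetSum _ hi, ← Divisor.sum_multiplicity]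
  push_cast
  rw [Finset.mul_sum, Finset.sum_mul]
  refine Finset.sum_congr rfl fun P hP => ?_
  rw [integral_const_mul, (h₁ P hP ψ hψ hc hs).2]
  ring

end HyperellipticCurve

namespace HyperellipticCurve

variable {g : ℕ} {E : HyperellipticEquation g}

/-! ### Test functions -/

theorem contDiffAt_comp_chart_symm {φ : HyperellipticCurve E → ℂ}
    (hφ : ContMDiff 𝓘(ℝ, ℂ) 𝓘(ℝ, ℂ) ∞ φ) {P : HyperellipticCurve E} {ζ : ℂ}
    (hζ : ζ ∈ (chart P).target) : ContDiffAt ℝ ∞ (φ ∘ (chart P).symm) ζ := by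
  have h := (contMDiffOn_symm_of_mem_maximalAtlas (I := 𝓘(ℝ, ℂ)) (n := ∞)
    (IsManifold.subset_maximalAtlas (mem_range_self P))).contMDiffAt
    ((chart P).open_target.mem_nhds hζ)
  exact (hφ.contMDiffAt.comp _ h).contDiffAt

theorem laplaceBeltrami_add {φ₁ φ₂ : HyperellipticCurve E → ℂ}
    (h₁ : ContMDiff 𝓘(ℝ, ℂ) 𝓘(ℝ, ℂ) ∞ φ₁) (h₂ : ContMDiff 𝓘(ℝ, ℂ) 𝓘(ℝ, ℂ) ∞ φ₂)
    (Q : HyperellipticCurve E) :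
    laplaceBeltrami (φ₁ + φ₂) Q = laplaceBeltrami φ₁ Q + laplaceBeltrami φ₂ Q := by
  have hQ : chart Q Q ∈ (chart Q).target := (chart Q).map_source (mem_chart_source' Q)
  have h := ((contDiffAt_comp_chart_symm h₁ hQ).of_le (by decide)).laplacian_add
    ((contDiffAt_comp_chart_symm h₂ hQ).of_le (by decide))
  change Δ (φ₁ ∘ (chart Q).symm + φ₂ ∘ (chart Q).symm) (chart Q Q) / _ =
    Δ (φ₁ ∘ (chart Q).symm) (chart Q Q) / _ + Δ (φ₂ ∘ (chart Q).symm) (chart Q Q) / _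
  rw [h, add_div]

theorem laplaceBeltrami_eq_zero_of_notMem_tsupport {φ : HyperellipticCurve E → ℂ}
    {Q : HyperellipticCurve E} (hQ : Q ∉ tsupport φ) : laplaceBeltrami φ Q = 0 := by
  have hc : Tendsto (chart Q).symm (𝓝 (chart Q Q)) (𝓝 Q) := by
    have := (chart Q).symm.continuousAt ((chart Q).map_source (mem_chart_source' Q))
    rwa [ContinuousAt, (chart Q).left_inv (mem_chart_source' Q)] at this
  have h : φ ∘ (chart Q).symm =ᶠ[𝓝 (chart Q Q)] fun _ => 0 :=
    hc.eventually (notMem_tsupport_iff_eventuallyEq.1 hQ)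
  change Δ (φ ∘ (chart Q).symm) (chart Q Q) / _ = 0
  rw [(InnerProductSpace.laplacian_congr_nhds h).eq_of_nhds]
  simp

/-- The expression in `chart P` of a function on `X`, extended by zero to the plane. -/
noncomputable def inChart (P : HyperellipticCurve E) (φ : HyperellipticCurve E → ℂ) : ℂ → ℂ :=
  (chart P).target.indicator (φ ∘ (chart P).symm)

theorem isCompact_image_tsupport {P : HyperellipticCurve E} {φ : HyperellipticCurve E → ℂ}
    (hs : tsupport φ ⊆ (chart P).source) : IsCompact (chart P '' tsupport φ) :=
  (isClosed_tsupport φ).isCompact.image_of_continuousOn ((chart P).continuousOn.mono hs)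

theorem tsupport_inChart_subset {P : HyperellipticCurve E} {φ : HyperellipticCurve E → ℂ}
    (hs : tsupport φ ⊆ (chart P).source) : tsupport (inChart P φ) ⊆ chart P '' tsupport φ := by
  refine closure_minimal (fun ζ hζ => ?_) (isCompact_image_tsupport hs).isClosed
  have hζt : ζ ∈ (chart P).target := by
    by_contra h
    exact hζ (indicator_of_notMem h _)
  refine ⟨(chart P).symm ζ, subset_tsupport _ ?_, (chart P).right_inv hζt⟩
  rwa [Function.mem_support, inChart, indicator_of_mem hζt] at hζ

theorem hasCompactSupport_inChart {P : HyperellipticCurve E} {φ : HyperellipticCurve E → ℂ}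
    (hs : tsupport φ ⊆ (chart P).source) : HasCompactSupport (inChart P φ) :=
  (isCompact_image_tsupport hs).of_isClosed_subset (isClosed_tsupport _)
    (tsupport_inChart_subset hs)

theorem inChart_eventuallyEq {P : HyperellipticCurve E} (φ : HyperellipticCurve E → ℂ) {ζ : ℂ}
    (hζ : ζ ∈ (chart P).target) : inChart P φ =ᶠ[𝓝 ζ] φ ∘ (chart P).symm := by
  filter_upwards [(chart P).open_target.mem_nhds hζ] with z hz using indicator_of_mem hz _

theorem contDiff_inChart {P : HyperellipticCurve E} {φ : HyperellipticCurve E → ℂ}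
    (hφ : ContMDiff 𝓘(ℝ, ℂ) 𝓘(ℝ, ℂ) ∞ φ) (hs : tsupport φ ⊆ (chart P).source) :
    ContDiff ℝ ∞ (inChart P φ) := by
  refine contDiff_iff_contDiffAt.2 fun ζ => ?_
  by_cases hζ : ζ ∈ (chart P).target
  · exact (contDiffAt_comp_chart_symm hφ hζ).congr_of_eventuallyEq (inChart_eventuallyEq φ hζ)
  · have h : ζ ∉ tsupport (inChart P φ) := fun h => by
      obtain ⟨Q, hQ, rfl⟩ := tsupport_inChart_subset hs h
      exact hζ ((chart P).map_source (hs hQ))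
    exact (contDiffAt_const (c := (0 : ℂ))).congr_of_eventuallyEq
      (notMem_tsupport_iff_eventuallyEq.1 h)

theorem conformalFactor_mul_ae_eq (hg : 1 ≤ g) (P : HyperellipticCurve E)
    (u : HyperellipticCurve E → ℝ) {φ : HyperellipticCurve E → ℂ}
    (hφ : ContMDiff 𝓘(ℝ, ℂ) 𝓘(ℝ, ℂ) ∞ φ) :
    (fun ζ => (conformalFactor (chart P) ζ : ℂ) *
      ((u ((chart P).symm ζ) : ℂ) * laplaceBeltrami φ ((chart P).symm ζ)))
      =ᵐ[volume.restrict (chart P).target]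
      fun ζ => (u ((chart P).symm ζ) : ℂ) * Δ (inChart P φ) ζ := by
  filter_upwards [ae_target_symm_notMem P finite_compl_generic,
    ae_restrict_mem (chart P).open_target.measurableSet] with ζ h₁ h₂
  rw [(InnerProductSpace.laplacian_congr_nhds (inChart_eventuallyEq φ h₂)).eq_of_nhds,
    ← laplaceBeltrami_mul_conformalFactor hg hφ h₂ (not_not.1 h₁)]
  ring

/-- For test functions supported in a chart, integrals over `X` are integrals over the plane. -/
theorem integral_mul_laplaceBeltrami (hg : 1 ≤ g) (P : HyperellipticCurve E)
    (u : HyperellipticCurve E → ℝ) {φ : HyperellipticCurve E → ℂ}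
    (hφ : ContMDiff 𝓘(ℝ, ℂ) 𝓘(ℝ, ℂ) ∞ φ) (hs : tsupport φ ⊆ (chart P).source) :
    (Integrable (fun ζ => (u ((chart P).symm ζ) : ℂ) * Δ (inChart P φ) ζ) →
      Integrable (fun R => (u R : ℂ) * laplaceBeltrami φ R) area) ∧
    ∫ R, (u R : ℂ) * laplaceBeltrami φ R ∂area =
      ∫ ζ, (u ((chart P).symm ζ) : ℂ) * Δ (inChart P φ) ζ := by
  have h₀ : ∀ R ∉ (chart P).source, (u R : ℂ) * laplaceBeltrami φ R = 0 := fun R hR => by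
    rw [laplaceBeltrami_eq_zero_of_notMem_tsupport fun h => hR (hs h), mul_zero]
  have h₁ : ∀ ζ ∉ (chart P).target, (u ((chart P).symm ζ) : ℂ) * Δ (inChart P φ) ζ = 0 :=
    fun ζ hζ => by
      rw [laplacian_eq_zero_of_notMem_tsupport, mul_zero]
      intro h
      obtain ⟨Q, hQ, rfl⟩ := tsupport_inChart_subset hs h
      exact hζ ((chart P).map_source (hs hQ))
  constructor
  · intro h
    have h₂ : Function.support (fun R => (u R : ℂ) * laplaceBeltrami φ R) ⊆ (chart P).source :=
      fun R hR => by
        by_contra h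
        exact hR (h₀ R h)
    rw [← integrableOn_iff_integrable_of_support_subset h₂, integrableOn_source_iff]
    exact h.integrableOn.congr (conformalFactor_mul_ae_eq hg P u hφ).symm
  · rw [← setIntegral_eq_integral_of_forall_compl_eq_zero h₀, setIntegral_source,
      ← setIntegral_eq_integral_of_forall_compl_eq_zero h₁]
    exact integral_congr_ae (conformalFactor_mul_ae_eq hg P u hφ)

/-! ### The Laplacian of `u_D` -/

theorem Divisor.dirac_eq_sum (D : Divisor E) (φ : SmoothFunction E) :
    D.dirac φ = ∑ Q ∈ D.support, (D Q : ℂ) * φ Q := by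
  have h : D.dirac φ = ∑ Q ∈ D.support, (D Q • HyperellipticCurve.dirac Q) φ := by
    rw [Divisor.dirac, Finsupp.sum]
    exact sum_apply _ _ _
  rw [h]
  refine Finset.sum_congr rfl fun Q _ => ?_
  rw [smul_apply, zsmul_eq_mul]
  rfl

/-- The equation `Δ u_D = 2π δ_{D + ι(D)}` holds when tested against the smooth function `φ`, with
the left side read as the absolutely convergent integral of `u_D Δφ` over all of `X`. -/
def IsTested (D : Divisor E) (φ : HyperellipticCurve E → ℂ) : Prop :=
  ContMDiff 𝓘(ℝ, ℂ) 𝓘(ℝ, ℂ) ∞ φ ∧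
    Integrable (fun R => (D.u R : ℂ) * laplaceBeltrami φ R) area ∧
    ∫ R, (D.u R : ℂ) * laplaceBeltrami φ R ∂area =
      2 * Real.pi * ∑ Q ∈ (D + D.involution).support, ((D + D.involution) Q : ℂ) * φ Q

theorem IsTested.add {D : Divisor E} {φ₁ φ₂ : HyperellipticCurve E → ℂ} (h₁ : IsTested D φ₁)
    (h₂ : IsTested D φ₂) : IsTested D (φ₁ + φ₂) := by
  have h : (fun R => (D.u R : ℂ) * laplaceBeltrami (φ₁ + φ₂) R) =
      fun R => (D.u R : ℂ) * laplaceBeltrami φ₁ R + (D.u R : ℂ) * laplaceBeltrami φ₂ R := by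
    ext R
    rw [laplaceBeltrami_add h₁.1 h₂.1, mul_add]
  refine ⟨h₁.1.add h₂.1, ?_, ?_⟩
  · rw [h]
    exact h₁.2.1.add h₂.2.1
  · rw [h, integral_add h₁.2.1 h₂.2.1, h₁.2.2, h₂.2.2, ← mul_add, ← Finset.sum_add_distrib]
    congr 1
    exact Finset.sum_congr rfl fun Q _ => by rw [Pi.add_apply, mul_add]

theorem IsTested.zero (D : Divisor E) : IsTested D 0 := by
  have h (R : HyperellipticCurve E) : laplaceBeltrami (0 : HyperellipticCurve E → ℂ) R = 0 :=
    laplaceBeltrami_eq_zero_of_notMem_tsupport (by simp [tsupport])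
  refine ⟨contMDiff_const, ?_, ?_⟩ <;> simp [h]

/-- The equation holds for test functions supported near a given point. -/
theorem eventually_isTested (hg : 1 ≤ g) {D : Divisor E} (hD : D.deg = 0)
    (P : HyperellipticCurve E) :
    ∀ᶠ U in (𝓝 P).smallSets, ∀ φ : HyperellipticCurve E → ℂ, ContMDiff 𝓘(ℝ, ℂ) 𝓘(ℝ, ℂ) ∞ φ →
      tsupport φ ⊆ U → IsTested D φ := by
  obtain ⟨V, hV, hVD⟩ := eventually_smallSets.1 (eventually_integral_u_mul_laplacian hg hD P)
  have h₁ : (chart P).source ∈ 𝓝 P := (chart P).open_source.mem_nhds (mem_chart_source' P)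
  have h₂ : chart P ⁻¹' V ∈ 𝓝 P := (chart P).continuousAt (mem_chart_source' P) hV
  have h₃ : ∀ᶠ Q in 𝓝 P, ∀ R ∈ (D + D.involution).support, Q = R → R = P := by
    refine (Filter.eventually_all_finset _).2 fun R _ => ?_
    by_cases h : R = P
    · exact Eventually.of_forall fun _ _ => h
    · filter_upwards [isOpen_ne.mem_nhds (Ne.symm h)] with Q hQ hQR using absurd hQR hQ
  filter_upwards [eventually_smallSets_subset.2 h₁, eventually_smallSets_subset.2 h₂,
    eventually_smallSets_subset.2 h₃] with U hU₁ hU₂ hU₃ φ hφ hs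
  have hsrc := hs.trans hU₁
  have hsV : tsupport (inChart P φ) ⊆ V := by
    refine (tsupport_inChart_subset hsrc).trans ?_
    rintro _ ⟨Q, hQ, rfl⟩
    exact hU₂ (hs hQ)
  obtain ⟨hi, he⟩ := hVD V Subset.rfl (inChart P φ) (contDiff_inChart hφ hsrc)
    (hasCompactSupport_inChart hsrc) hsV
  obtain ⟨hi', he'⟩ := integral_mul_laplaceBeltrami hg P D.u hφ hsrc
  refine ⟨hφ, hi' hi, ?_⟩
  have hval : inChart P φ (chart P P) = φ P := by
    rw [(inChart_eventuallyEq φ ((chart P).map_source (mem_chart_source' P))).eq_of_nhds,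
      Function.comp_apply, (chart P).left_inv (mem_chart_source' P)]
  rw [he', he, hval, mul_assoc]
  congr 1
  symm
  refine Finset.sum_eq_single P (fun Q hQ hQP => ?_) fun hP => ?_
  · have : Q ∉ tsupport φ := fun h => hQP (hU₃ (hs h) Q hQ rfl)
    rw [image_eq_zero_of_notMem_tsupport this, mul_zero]
  · rw [Finsupp.notMem_support_iff.1 hP]
    simp

/-- The passage from local to global, by a partition of unity. -/
theorem isTested_of_contMDiff (hg : 1 ≤ g) {D : Divisor E} (hD : D.deg = 0)
    {φ : HyperellipticCurve E → ℂ} (hφ : ContMDiff 𝓘(ℝ, ℂ) 𝓘(ℝ, ℂ) ∞ φ) : IsTested D φ := by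
  choose V hV hVD using fun P => eventually_smallSets.1 (eventually_isTested hg hD P)
  obtain ⟨χ, hχ⟩ := SmoothPartitionOfUnity.exists_isSubordinate 𝓘(ℝ, ℂ)
    (isClosed_univ (X := HyperellipticCurve E)) (fun P => interior (V P))
    (fun P => isOpen_interior) fun P _ => mem_iUnion.2 ⟨P, mem_interior_iff_mem_nhds.2 (hV P)⟩
  have hfin := χ.locallyFinite.finite_nonempty_of_compact
  have hsum : φ = ∑ P ∈ hfin.toFinset, fun Q => (χ P Q : ℂ) * φ Q := by
    ext Q
    have h₁ : ∑ P ∈ hfin.toFinset, χ P Q = 1 := by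
      rw [← χ.sum_eq_one (mem_univ Q)]
      refine (finsum_eq_sum_of_support_subset _ fun P hP => ?_).symm
      exact Finset.mem_coe.2 (hfin.mem_toFinset.2 ⟨Q, hP⟩)
    rw [Finset.sum_apply, ← Finset.sum_mul, ← Complex.ofReal_sum, h₁]
    simp
  rw [hsum]
  refine Finset.sum_induction _ (IsTested D) (fun _ _ => IsTested.add) (IsTested.zero D)
    fun P _ => ?_
  refine hVD P (V P) Subset.rfl _ ?_ ?_
  · have h : (fun Q => (χ P Q : ℂ) * φ Q) = ⇑(χ P) • φ := by
      ext Q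
      simp
    rw [h]
    exact (χ P).contMDiff.smul hφ
  · refine (closure_mono fun Q hQ => ?_).trans ((hχ P).trans interior_subset)
    intro h
    exact hQ (by simp [h])

/-- The coordinate discs shrink to their centres, so that removing them does not affect the
integral in the limit. -/
theorem tendsto_setIntegral_compl_discs {F : HyperellipticCurve E → ℂ} (hF : Integrable F area)
    {S : Finset (HyperellipticCurve E)}
    {ψ : HyperellipticCurve E → OpenPartialHomeomorph (HyperellipticCurve E) ℂ}
    (hψ : ∀ Q ∈ S, IsCentredCoordinate (ψ Q) Q) :
    Tendsto (fun ε : ℝ => ∫ R in (⋃ Q ∈ S, coordinateDisc (ψ Q) ε)ᶜ, F R ∂area) (𝓝[>] 0)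
      (𝓝 (∫ R, F R ∂area)) := by
  have hm (ε : ℝ) : MeasurableSet (⋃ Q ∈ S, coordinateDisc (ψ Q) ε)ᶜ := by
    refine (Finset.measurableSet_biUnion _ fun Q _ => ?_).compl
    have h : coordinateDisc (ψ Q) ε = Subtype.val ''
        {R : (ψ Q).source | ‖(ψ Q).source.domRestrict (ψ Q) R‖ ≤ ε} := by
      ext R
      simp [coordinateDisc, and_comm]
    rw [h]
    refine (ψ Q).open_source.measurableSet.subtype_image (IsClosed.measurableSet ?_)
    exact isClosed_le (continuousOn_iff_continuous_domRestrict.1 (ψ Q).continuousOn).norm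
      continuous_const
  simp only [← integral_indicator (hm _)]
  refine tendsto_integral_filter_of_dominated_convergence (fun R => ‖F R‖) ?_ ?_ hF.norm ?_
  · exact Eventually.of_forall fun ε => hF.aestronglyMeasurable.indicator (hm ε)
  · exact Eventually.of_forall fun ε => Eventually.of_forall fun R =>
      norm_indicator_le_norm_self _ _
  · filter_upwards [S.countable_toSet.ae_notMem area] with R hR
    refine tendsto_const_nhds.congr' ?_
    have h : ∀ᶠ ε : ℝ in 𝓝[>] 0, ∀ Q ∈ S, R ∉ coordinateDisc (ψ Q) ε := by
      refine (Filter.eventually_all_finset _).2 fun Q hQ => ?_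
      by_cases hRs : R ∈ (ψ Q).source
      · have hne : ψ Q R ≠ 0 := fun h => by
          have := (ψ Q).injOn hRs (hψ Q hQ).2.1 (h.trans (hψ Q hQ).2.2.symm)
          exact hR (this ▸ hQ)
        filter_upwards [Ioo_mem_nhdsGT (norm_pos_iff.2 hne)] with ε hε h
        exact not_le.2 hε.2 h.2
      · exact Eventually.of_forall fun ε h => hRs h.1
    filter_upwards [h] with ε hε
    rw [indicator_of_mem]
    simpa using hε

end HyperellipticCurve

theorem mainTheorem7 (g : ℕ) (hg : 2 ≤ g) (E : HyperellipticEquation g)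
    (D : HyperellipticCurve.Divisor E) (hD : D.deg = 0) :
    HyperellipticCurve.HasLaplacian D.u (D + D.involution).support
      ((2 * Real.pi : ℂ) • (D + D.involution).dirac) := by
  intro φ
  obtain ⟨-, hi, he⟩ := HyperellipticCurve.isTested_of_contMDiff (by omega) hD φ.2
  refine ⟨hi, fun ψ hψ => ?_⟩
  rw [smul_apply, smul_eq_mul, HyperellipticCurve.Divisor.dirac_eq_sum, ← he]
  exact HyperellipticCurve.tendsto_setIntegral_compl_discs hi hψ
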